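/- Let $p\in\,]1,2]$, let $q=p/(p-1)$, let $\mathbb K$ be a countable set, $\gamma>0$, $\Phi\colon\mathcal X\to\ell^q(\mathbb K)$, $x_1,\dots,x_n\in\mathcal X$, $y_1,\dots,y_n\in\mathcal Y$, and let $L\colon\mathcal Y\times\mathbb R\to\mathbb R$ be convex in its second variable. Consider the primal problem $$\min_{w\in\ell^p(\mathbb K)} F(w)=\gamma\sum_{i=1}^n L\big(y_i,\langle \Phi(x_i),w\rangle\big)+\frac1p\|w\|_p^p$$ and its dual $$\min_{\alpha\in\mathbb R^n}\Lambda(\alpha)=\frac1q\|\Phi_n^*\alpha\|_q^q+\gamma\sum_{i=1}^n L^*\Big(y_i,-\frac{\alpha_i}{\gamma}\Big),\qquad \Phi_n^*\alpha=\sum_{i=1}^n\alpha_i\Phi(x_i),$$ where $L^*(y,\cdot)$ is the Fenchel conjugate of $L(y,\cdot)$. Let $J_q\colon\ell^q(\mathbb K)\to\ell^p(\mathbb K)$, $J_q(u)=(\operatorname{sign}(u_k)|u_k|^{q-1})_{k\in\mathbb K}$, be the duality map. Suppose that $\Lambda=\varphi_1+\varphi_2$, where $\varphi_1\colon\mathbb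 R^n\to\mathbb R$ is convex and differentiable with locally Lipschitz continuous gradient and $\varphi_2\colon\mathbb R^n\to\mathbb R\cup\{+\infty\}$ is proper, lower semicontinuous and convex. Let $\delta,\theta\in\,]0,1[$, $\bar\lambda>0$, $\alpha_0\in\mathbb R^n$, and define for every $m\in\mathbb N$ $$\alpha_{m+1}=\operatorname{prox}_{\lambda_m\varphi_2}\big(\alpha_m-\lambda_m\nabla\varphi_1(\alpha_m)\big),\qquad \lambda_m=\bar\lambda\theta^{j_m},$$ where $j_m$ is the smallest $j\in\mathbb N$ such that $\hat\alpha_m(j)=\operatorname{prox}_{\bar\lambda\theta^j\varphi_2}\big(\alpha_m-\bar\lambda\theta^j\nabla\varphi_1(\alpha_m)\big)$ satisfies $$\varphi_1(\hat\alpha_m(j))-\varphi_1(\alpha_m)-\langle\hat\alpha_m(j)-\alpha_m,\nabla\varphi_1(\alpha_m)\rangle\le\frac{\delta}{\bar\lambda\theta^j}\|\hat\alpha_m(j)-\alpha_m\|^2 .$$ Then the primal problem has a unique solution $\bar w$, the sequences $(\alpha_m)$ and $(\lambda_m)$ are well defined for every $\alpha_0\in\mathbb R^n$, $\inf_m\lambda_m>0$,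 and, setting $w_m=J_q(\Phi_n^*\alpha_m)$, $$\|w_m-\bar w\|_p=o(1/\sqrt m)\quad\text{as } m\to\infty .$$ Moreover, if $\Lambda$ is strongly convex, then $w_m$ converges linearly to $\bar w$: there are $C\ge 0$ and $\rho\in\,]0,1[$ with $\|w_m-\bar w\|_p\le C\rho^m$ for every $m\in\mathbb N$. The function $\Lambda$ is strongly convex for the least squares loss $L(y,t)=\frac12|y-t|^2$ ($\mathcal Y=\mathbb R$) and for the logistic loss $L(y,t)=\log(1+e^{-yt})$ ($\mathcal Y=\{-1,1\}$). -/

import Mathlib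

open Filter Topology Asymptotics

namespace DualLp

noncomputable section

/-- The Banach space `ℓ^r(K)` of real families indexed by `K`, for a real exponent `r`. -/
abbrev Ell (r : ℝ) (K : Type*) : Type _ := lp (fun _ : K => ℝ) (ENNReal.ofReal r)

/-- `ℝⁿ` with its Euclidean structure. -/
abbrev E (n : ℕ) : Type := EuclideanSpace ℝ (Fin n)

/-! ### Convex analysis for functions with values in the extended reals -/

section ConvexAnalysis

/-- Convexity of an extended-real-valued function (used only for functions that never take the
value `⊥`). -/
def EConvex {V : Type*} [AddCommGroup V] [Module ℝ V] (f : V → EReal) : Prop :=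
  ∀ u v : V, ∀ t : ℝ, 0 < t → t < 1 →
    f (t • u + (1 - t) • v) ≤ (t : EReal) * f u + ((1 - t : ℝ) : EReal) * f v

/-- Strong convexity of modulus `μ` of an extended-real-valued function (used only for functions
that never take the value `⊥`). -/
def EStronglyConvexWith {V : Type*} [NormedAddCommGroup V] [NormedSpace ℝ V] (μ : ℝ)
    (f : V → EReal) : Prop :=
  ∀ u v : V, ∀ t : ℝ, 0 < t → t < 1 →
    f (t • u + (1 - t) • v) + ((μ / 2 * t * (1 - t) * ‖u - v‖ ^ 2 : ℝ) : EReal) ≤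
      (t : EReal) * f u + ((1 - t : ℝ) : EReal) * f v

/-- Strong convexity: strong convexity of some positive modulus. -/
def EStronglyConvex {V : Type*} [NormedAddCommGroup V] [NormedSpace ℝ V] (f : V → EReal) : Prop :=
  ∃ μ : ℝ, 0 < μ ∧ EStronglyConvexWith μ f

/-- A function with values in `]-∞, +∞]` that is not identically `+∞`. -/
def EProper {V : Type*} (f : V → EReal) : Prop :=
  (∀ v, f v ≠ ⊥) ∧ ∃ v, f v ≠ ⊤

/-- The Fenchel conjugate of a real function on the line, `s ↦ sup_t (s t - f t)`. -/
def conjugate (f : ℝ → ℝ) (s : ℝ) : EReal :=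
  ⨆ t : ℝ, ((s * t - f t : ℝ) : EReal)

/-- `u = prox_{r f}(z)`: `u` minimizes `v ↦ f v + (1 / (2 r)) ‖v - z‖²`. -/
def IsProx {n : ℕ} (r : ℝ) (f : E n → EReal) (z u : E n) : Prop :=
  IsMinOn (fun v => f v + ((1 / (2 * r) * ‖v - z‖ ^ 2 : ℝ) : EReal)) Set.univ u

end ConvexAnalysis

/-! ### The primal and dual problems -/

section Problems

variable {X Y K : Type*} {p q : ℝ}

/-- The duality pairing of `ℓ^q(K)` and `ℓ^p(K)` for conjugate exponents. -/
def pairing (u : Ell q K) (w : Ell p K) : ℝ := ∑' k, u k * w k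

/-- The componentwise map `u ↦ sign(u) |u|^(q-1)` sends `ℓ^q` to `ℓ^p`. -/
theorem memℓp_dualityMap (hpq : p.HolderConjugate q) (u : Ell q K) :
    Memℓp (fun k => Real.sign (u k) * |u k| ^ (q - 1)) (ENNReal.ofReal p) := by
  have hp : 0 < p := hpq.pos
  have hq : 0 < q := hpq.symm.pos
  have hp' : (ENNReal.ofReal p).toReal = p := ENNReal.toReal_ofReal hp.le
  have hq' : (ENNReal.ofReal q).toReal = q := ENNReal.toReal_ofReal hq.le
  have hu := (lp.memℓp u).summable (by rw [hq']; exact hq)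
  rw [hq'] at hu
  refine memℓp_gen ?_
  rw [hp']
  refine hu.congr fun k => ?_
  by_cases h : u k = 0
  · simp [h, Real.zero_rpow hp.ne', Real.zero_rpow hq.ne']
  · have hs : |Real.sign (u k)| = 1 := by
      rcases Real.sign_apply_eq_of_ne_zero _ h with h' | h' <;> simp [h']
    rw [Real.norm_eq_abs, Real.norm_eq_abs, abs_mul, hs, one_mul,
      abs_of_nonneg (Real.rpow_nonneg (abs_nonneg _) _), ← Real.rpow_mul (abs_nonneg _),
      hpq.symm.sub_one_mul_conj]

/-- The duality map `J_q : ℓ^q(K) → ℓ^p(K)`, the gradient of `(1/q) ‖·‖_q^q`; it acts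
componentwise as the derivative `sign(·) |·|^(q-1)` of `(1/q) |·|^q`. -/
def dualityMap (hpq : p.HolderConjugate q) (u : Ell q K) : Ell p K :=
  ⟨fun k => Real.sign (u k) * |u k| ^ (q - 1), memℓp_dualityMap hpq u⟩

/-- The adjoint feature operator `Φₙ* α = ∑ᵢ αᵢ Φ(xᵢ)`. -/
def featureAdj {n : ℕ} (Φ : X → Ell q K) (x : Fin n → X) (α : E n) : Ell q K :=
  ∑ i, α i • Φ (x i)

/-- The primal objective `F(w) = γ ∑ᵢ L(yᵢ, ⟨Φ(xᵢ), w⟩) + (1/p) ‖w‖_p^p`. -/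
def primalObj {n : ℕ} (γ : ℝ) (Φ : X → Ell q K) (L : Y → ℝ → ℝ) (x : Fin n → X) (y : Fin n → Y)
    (w : Ell p K) : ℝ :=
  γ * ∑ i, L (y i) (pairing (Φ (x i)) w) + 1 / p * ‖w‖ ^ p

/-- The dual objective `Λ(α) = (1/q) ‖Φₙ* α‖_q^q + γ ∑ᵢ L*(yᵢ, -αᵢ/γ)`, where `L*(y, ·)` is the
Fenchel conjugate of `L(y, ·)`. -/
def dualObj {n : ℕ} (γ : ℝ) (Φ : X → Ell q K) (L : Y → ℝ → ℝ) (x : Fin n → X) (y : Fin n → Y)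
    (α : E n) : EReal :=
  ((1 / q * ‖featureAdj Φ x α‖ ^ q : ℝ) : EReal) +
    (γ : EReal) * ∑ i, conjugate (L (y i)) (-(α i) / γ)

end Problems

/-- The least squares loss, with labels in `ℝ`. -/
def leastSquaresLoss (y t : ℝ) : ℝ := 1 / 2 * |y - t| ^ 2

/-- The logistic loss, with labels in `{-1, 1}`. -/
def logisticLoss (y : ({-1, 1} : Set ℝ)) (t : ℝ) : ℝ := Real.log (1 + Real.exp (-((y : ℝ) * t)))

/-! ### The dual proximal gradient algorithm with backtracking -/

section Algorithm

variable {n : ℕ}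

/-- The stepsize `r` passes the linesearch test at the point `a`: the trial point
`u = prox_{r φ₂}(a - r ∇φ₁(a))` satisfies
`φ₁(u) - φ₁(a) - ⟨u - a, ∇φ₁(a)⟩ ≤ (δ / r) ‖u - a‖²`. -/
def LinesearchTest (φ₁ : E n → ℝ) (φ₂ : E n → EReal) (δ : ℝ) (a : E n) (r : ℝ) : Prop :=
  ∃ u : E n, IsProx r φ₂ (a - r • gradient φ₁ a) u ∧
    φ₁ u - φ₁ a - inner ℝ (u - a) (gradient φ₁ a) ≤ δ / r * ‖u - a‖ ^ 2

/-- The sequences `α` (iterates) and `lam` (stepsizes) are generated by the proximal gradient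
algorithm with backtracking: `lam m = lamBar * θ ^ j` for the least `j` such that
`lamBar * θ ^ j` passes the linesearch test at `α m`, and
`α (m + 1) = prox_{lam m φ₂}(α m - lam m ∇φ₁(α m))`. -/
structure IsProxGradRun (φ₁ : E n → ℝ) (φ₂ : E n → EReal) (δ θ lamBar : ℝ)
    (α : ℕ → E n) (lam : ℕ → ℝ) : Prop where
  stepsize : ∀ m, ∃ j : ℕ,
    IsLeast {j : ℕ | LinesearchTest φ₁ φ₂ δ (α m) (lamBar * θ ^ j)} j ∧ lam m = lamBar * θ ^ j
  step : ∀ m, IsProx (lam m) φ₂ (α m - lam m • gradient φ₁ (α m)) (α (m + 1))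

end Algorithm

end

end DualLp

open DualLp

/-! Everything is measured by the Young gap `‖w‖_p^p / p + ‖u‖_q^q / q - ⟨u, w⟩`, which is
nonnegative and vanishes at `w = J_q u`. Since `p ≤ 2`, the function `|·|^p / p` has curvature at
least `(p-1) M^(p-2)` on `[-M, M]`. Summing the resulting scalar estimate by Hölder gives `‖w - J_q
u‖² ≤ C · gap` on bounded sets (`exists_sq_norm_sub_dualityMap_le`).

The dual objective is coercive because the losses are finite, so it has a minimizer `abar`; put
`wbar = J_q(Φₙ* abar)`. First-order optimality of `abar`, tested against a point built from
subgradients of the losses at `⟨Φ(xᵢ), wbar⟩`, yields Fenchel equality for the losses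
(`sum_conjugate_le_of_isMinOn`). Combined with Fenchel–Young, it bounds the gap in two ways. The gap
between `Φₙ* abar` and `w` is at most the primal excess of `w`, so `wbar` is the unique primal
solution. The gap between `Φₙ* α` and `wbar` is at most the dual excess of `α`. Hence `‖w_m -
wbar‖²` is bounded by a constant times the dual excess, as long as the iterates stay bounded.

For the algorithm, a Lyapunov function (squared distance to `abar` plus a multiple of the dual
excess) decreases. This bounds the iterates, hence bounds the stepsizes from below, hence makes the
excesses summable. Being also nonincreasing, they are `o(1/m)`. Under strong convexity the excess
controls the Lyapunov function, which then contracts geometrically. Strong convexity for the two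
losses comes from their 1-smoothness, which makes the conjugates 1-strongly convex. -/

namespace DualLp

/-! ### Scalar Young gap. -/

section Scalar

variable {p q : ℝ}

theorem sign_mul_self_eq_abs (s : ℝ) : Real.sign s * s = |s| := by
  rcases lt_trichotomy s 0 with h | rfl | h
  · rw [Real.sign_of_neg h, abs_of_neg h]; ring
  · simp
  · rw [Real.sign_of_pos h, abs_of_pos h, one_mul]

theorem sign_mul_abs_eq_self (s : ℝ) : Real.sign s * |s| = s := by
  rcases lt_trichotomy s 0 with h | rfl | h
  · rw [Real.sign_of_neg h, abs_of_neg h]; ring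
  · simp
  · rw [Real.sign_of_pos h, abs_of_pos h, one_mul]

theorem abs_sign_mul_abs_rpow {s r : ℝ} (hr : 0 < r) : |Real.sign s * |s| ^ r| = |s| ^ r := by
  rcases eq_or_ne s 0 with rfl | h
  · simp [Real.zero_rpow hr.ne']
  · have hs : |Real.sign s| = 1 := by
      rcases Real.sign_apply_eq_of_ne_zero _ h with h' | h' <;> simp [h']
    rw [abs_mul, hs, one_mul, abs_of_nonneg (Real.rpow_nonneg (abs_nonneg _) _)]

theorem mul_sign_mul_abs_rpow (hq : 1 < q) (s : ℝ) :
    s * (Real.sign s * |s| ^ (q - 1)) = |s| ^ q := by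
  rcases eq_or_ne s 0 with rfl | h
  · simp [Real.zero_rpow (by linarith : q ≠ 0)]
  · have h1 : s * Real.sign s = |s| := by rw [mul_comm, sign_mul_self_eq_abs]
    rw [← mul_assoc, h1, ← Real.rpow_one_add' (abs_nonneg _) (by linarith)]
    ring_nf

theorem abs_sign_mul_abs_rpow_rpow (hpq : p.HolderConjugate q) (s : ℝ) :
    |Real.sign s * |s| ^ (q - 1)| ^ p = |s| ^ q := by
  rw [abs_sign_mul_abs_rpow hpq.symm.sub_one_pos, ← Real.rpow_mul (abs_nonneg _),
    hpq.symm.sub_one_mul_conj]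

theorem abs_rpow_sub_two_mul_sign (hpq : p.HolderConjugate q) (s : ℝ) :
    |Real.sign s * |s| ^ (q - 1)| ^ (p - 2) * (Real.sign s * |s| ^ (q - 1)) = s := by
  rcases eq_or_ne s 0 with rfl | h
  · simp
  · have hs : 0 < |s| := abs_pos.mpr h
    have h1 : (q - 1) * (p - 2) + (q - 1) = 1 := by
      have := hpq.mul_eq_add
      linarith
    rw [abs_sign_mul_abs_rpow hpq.symm.sub_one_pos, ← Real.rpow_mul hs.le, mul_left_comm,
      ← Real.rpow_add hs, h1, Real.rpow_one, sign_mul_abs_eq_self]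

/-- The derivative of `|x|^(p-2) x` is `(p-1)|x|^(p-2)`, at least `(p-1) M^(p-2)` on `[-M, M]`
because the exponent is nonpositive. Oddness reduces the claim to `[0, M]`, where the singular point
0 is only an endpoint. -/
theorem monotoneOn_abs_rpow_sub (hp1 : 1 < p) (hp2 : p ≤ 2) {M : ℝ} :
    MonotoneOn (fun x : ℝ => |x| ^ (p - 2) * x - (p - 1) * M ^ (p - 2) * x) (Set.Icc (-M) M) := by
  set κ := (p - 1) * M ^ (p - 2) with hκ
  set m := fun x : ℝ => |x| ^ (p - 2) * x - κ * x with hm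
  have hpos : ∀ x, 0 ≤ x → m x = x ^ (p - 1) - κ * x := by
    intro x hx
    rcases hx.eq_or_lt with rfl | h
    · simp [hm, Real.zero_rpow (by linarith : p - 1 ≠ 0)]
    · simp only [hm, abs_of_pos h]
      rw [← Real.rpow_add_one h.ne']
      ring_nf
  have hodd : ∀ x, m (-x) = - m x := by
    intro x; simp only [hm, abs_neg]; ring
  have hmono : MonotoneOn (fun x : ℝ => x ^ (p - 1) - κ * x) (Set.Icc 0 M) := by
    refine monotoneOn_of_deriv_nonneg (convex_Icc _ _) ?_ ?_ ?_
    · refine ContinuousOn.sub (continuousOn_id.rpow_const fun x _ => Or.inr (by linarith)) ?_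
      fun_prop
    · intro x hx
      rw [interior_Icc] at hx
      exact ((Real.differentiableAt_rpow_const_of_ne _ hx.1.ne').sub
        (by fun_prop)).differentiableWithinAt
    · intro x hx
      rw [interior_Icc] at hx
      have h1 : HasDerivAt (fun x : ℝ => x ^ (p - 1) - κ * x)
          ((p - 1) * x ^ (p - 1 - 1) - κ * 1) x :=
        (Real.hasDerivAt_rpow_const (Or.inl hx.1.ne')).sub ((hasDerivAt_id x).const_mul κ)
      rw [h1.deriv, hκ]
      have h2 : M ^ (p - 2) ≤ x ^ (p - 2) :=
        Real.rpow_le_rpow_of_nonpos hx.1 hx.2.le (by linarith)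
      have h3 : p - 1 - 1 = p - 2 := by ring
      rw [h3]
      nlinarith
  have hmono' : ∀ x y, 0 ≤ x → x ≤ y → y ≤ M → m x ≤ m y := by
    intro x y hx hxy hy
    rw [hpos x hx, hpos y (hx.trans hxy)]
    exact hmono ⟨hx, hxy.trans hy⟩ ⟨hx.trans hxy, hy⟩ hxy
  have h0 : m 0 = 0 := by simp [hm]
  intro x hx y hy hxy
  change m x ≤ m y
  rcases le_total 0 x with h | h
  · exact hmono' x y h hxy hy.2
  · rcases le_total 0 y with h' | h'
    · have h1 := hmono' 0 y le_rfl h' hy.2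
      have h2 := hmono' 0 (-x) le_rfl (by linarith) (by linarith [hx.1])
      rw [hodd] at h2
      linarith
    · have := hmono' (-y) (-x) (by linarith) (by linarith) (by linarith [hx.1])
      rw [hodd, hodd] at this
      linarith

/-- Quantitative Young inequality on the line. -/
theorem young_gap_ge_sq (hpq : p.HolderConjugate q) (hp2 : p ≤ 2) {b s M : ℝ}
    (hb : |b| ≤ M) (ha : |Real.sign s * |s| ^ (q - 1)| ≤ M) :
    (p - 1) / 2 * M ^ (p - 2) * (b - Real.sign s * |s| ^ (q - 1)) ^ 2 ≤
      1 / p * |b| ^ p + 1 / q * |s| ^ q - s * b := by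
  have hA := abs_sign_mul_abs_rpow_rpow hpq s
  have hB := mul_sign_mul_abs_rpow hpq.symm.lt s
  have hC := abs_rpow_sub_two_mul_sign hpq s
  set a := Real.sign s * |s| ^ (q - 1) with haa
  have hmono := monotoneOn_abs_rpow_sub hpq.lt hp2 (M := M)
  set κ := (p - 1) * M ^ (p - 2) with hκ
  have hderiv : ∀ x : ℝ, HasDerivAt (fun x : ℝ => 1 / p * |x| ^ p - κ / 2 * x ^ 2)
      (|x| ^ (p - 2) * x - κ * x) x := by
    intro x
    have h := ((hasDerivAt_abs_rpow x hpq.lt).const_mul (1 / p)).sub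
      ((hasDerivAt_pow 2 x).const_mul (κ / 2))
    refine h.congr_deriv ?_
    have := hpq.pos.ne'
    field_simp
    push_cast
    ring
  have hcont : Continuous (fun x : ℝ => 1 / p * |x| ^ p - κ / 2 * x ^ 2) :=
    continuous_iff_continuousAt.mpr fun x => (hderiv x).continuousAt
  -- The derivative of `|x|^p / p - κ x² / 2` is monotone on `[-M, M]` and equals `s - κ a` at `a`,
  -- so the tangent at `a` lies below; the mean value theorem makes this precise. Expanding with `s
  -- a = |s|^q` gives the claim.
  have key : (s - κ * a) * (b - a) ≤
      (1 / p * |b| ^ p - κ / 2 * b ^ 2) - (1 / p * |a| ^ p - κ / 2 * a ^ 2) := by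
    have hbM := abs_le.mp hb
    have haM := abs_le.mp ha
    rcases lt_trichotomy a b with h | h | h
    · obtain ⟨c, hc, hc'⟩ := exists_hasDerivAt_eq_slope _ _ h hcont.continuousOn
        (fun x _ => hderiv x)
      have := hmono (a := a) (b := c) ⟨haM.1, haM.2⟩
        ⟨by linarith [hc.1], by linarith [hc.2]⟩ hc.1.le
      rw [eq_div_iff (by linarith)] at hc'
      rw [← hc']
      simp only [hC] at this
      exact mul_le_mul_of_nonneg_right this (by linarith)
    · rw [h]; simp
    · obtain ⟨c, hc, hc'⟩ := exists_hasDerivAt_eq_slope _ _ h hcont.continuousOn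
        (fun x _ => hderiv x)
      have := hmono (a := c) (b := a) ⟨by linarith [hc.1], by linarith [hc.2]⟩
        ⟨haM.1, haM.2⟩ hc.2.le
      rw [eq_div_iff (by linarith)] at hc'
      simp only [hC] at this
      nlinarith
  rw [hA] at key
  have h1 : 1 / p + 1 / q = 1 := by
    simpa using hpq.inv_add_inv_eq_one
  have h2 : |s| ^ q = 1 / p * |s| ^ q + 1 / q * |s| ^ q := by
    rw [← add_mul, h1, one_mul]
  have h3 : (p - 1) / 2 * M ^ (p - 2) = κ / 2 := by rw [hκ]; ring
  rw [h3]
  nlinarith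

/-- Take `M = max |b| |a|` in the quadratic bound and eliminate it through `M^p ≤ |b|^p + |s|^q`.
The exponents `p/2` and `1 - p/2` add up to 1, so the product can be summed over coordinates by
Hölder. -/
theorem sq_sub_le_young_gap (hpq : p.HolderConjugate q) (hp2 : p ≤ 2) (b s : ℝ) :
    |b - Real.sign s * |s| ^ (q - 1)| ^ p ≤
      (2 / (p - 1) * (1 / p * |b| ^ p + 1 / q * |s| ^ q - s * b)) ^ (p / 2) *
        (|b| ^ p + |s| ^ q) ^ (1 - p / 2) ∧
    0 ≤ 1 / p * |b| ^ p + 1 / q * |s| ^ q - s * b := by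
  have hp1 := hpq.lt
  have hA := abs_sign_mul_abs_rpow_rpow hpq s
  have hmain := @young_gap_ge_sq p q hpq hp2 b s
  set a := Real.sign s * |s| ^ (q - 1) with haa
  set g := 1 / p * |b| ^ p + 1 / q * |s| ^ q - s * b with hg
  obtain ⟨M, hM⟩ : ∃ M, M = max |b| |a| := ⟨_, rfl⟩
  have hbM : |b| ≤ M := hM ▸ le_max_left _ _
  have haM : |a| ≤ M := hM ▸ le_max_right _ _
  rcases ((abs_nonneg b).trans hbM).eq_or_lt with h0 | h0
  · have hb : b = 0 := by
      have := hbM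
      rw [h0.symm] at this
      exact abs_eq_zero.mp (le_antisymm this (abs_nonneg _))
    have ha : a = 0 := by
      have := haM
      rw [h0.symm] at this
      exact abs_eq_zero.mp (le_antisymm this (abs_nonneg _))
    have hs : |s| ^ q = 0 := by rw [← hA, ha]; simp [Real.zero_rpow hpq.pos.ne']
    have hg0 : g = 0 := by rw [hg, hs, hb]; simp [Real.zero_rpow hpq.pos.ne']
    refine ⟨?_, hg0.ge⟩
    rw [hb, ha, hg0, hs]
    simp [Real.zero_rpow hpq.pos.ne', Real.zero_rpow (by linarith : p / 2 ≠ 0)]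
  have h1 := hmain hbM haM
  have hMp : 0 < M ^ (p - 2) := Real.rpow_pos_of_pos h0 _
  have hg0 : 0 ≤ g := le_trans (mul_nonneg (mul_nonneg (by linarith) hMp.le) (sq_nonneg _)) h1
  refine ⟨?_, hg0⟩
  have hMN : M ^ p ≤ |b| ^ p + |s| ^ q := by
    rw [← hA]
    rcases max_cases |b| |a| with h | h <;> rw [hM, h.1]
    · linarith [Real.rpow_nonneg (abs_nonneg a) p]
    · linarith [Real.rpow_nonneg (abs_nonneg b) p]
  have h2 : (b - a) ^ 2 ≤ 2 / (p - 1) * g * M ^ (2 - p) := by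
    have hinv : M ^ (2 - p) * M ^ (p - 2) = 1 := by
      rw [← Real.rpow_add h0]; simp
    have h3 : 0 < M ^ (2 - p) := Real.rpow_pos_of_pos h0 _
    have h4 := mul_le_mul_of_nonneg_left h1
      (mul_nonneg (div_nonneg zero_le_two (by linarith : 0 ≤ p - 1)) h3.le)
    have h5 : 2 / (p - 1) * M ^ (2 - p) * ((p - 1) / 2 * M ^ (p - 2) * (b - a) ^ 2) =
        (M ^ (2 - p) * M ^ (p - 2)) * (b - a) ^ 2 := by
      have : p - 1 ≠ 0 := by linarith
      field_simp
    rw [h5, hinv, one_mul] at h4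
    linarith
  have hcg : 0 ≤ 2 / (p - 1) * g := mul_nonneg (div_nonneg zero_le_two (by linarith)) hg0
  calc |b - a| ^ p = ((b - a) ^ 2) ^ (p / 2) := by
        rw [← sq_abs, ← Real.rpow_natCast, ← Real.rpow_mul (abs_nonneg _)]
        congr 1; push_cast; ring
    _ ≤ (2 / (p - 1) * g * M ^ (2 - p)) ^ (p / 2) :=
        Real.rpow_le_rpow (sq_nonneg _) h2 (by linarith)
    _ = (2 / (p - 1) * g) ^ (p / 2) * (M ^ p) ^ (1 - p / 2) := by
        rw [Real.mul_rpow hcg (Real.rpow_nonneg h0.le _), ← Real.rpow_mul h0.le,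
          ← Real.rpow_mul h0.le]
        congr 2; ring
    _ ≤ _ := mul_le_mul_of_nonneg_left
        (Real.rpow_le_rpow (Real.rpow_nonneg h0.le _) hMN (by linarith))
        (Real.rpow_nonneg hcg _)

end Scalar

/-! ### Young gap and duality map in sequence spaces. -/

section Lp

variable {K : Type*} {p q : ℝ}

noncomputable section

theorem hasSum_abs_rpow {r : ℝ} (hr : 0 < r) (u : Ell r K) :
    HasSum (fun k => |u k| ^ r) (‖u‖ ^ r) := by
  have h : (ENNReal.ofReal r).toReal = r := ENNReal.toReal_ofReal hr.le
  have := lp.hasSum_norm (by rw [h]; exact hr) u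
  rw [h] at this
  exact this

theorem hasSum_pairing (hpq : p.HolderConjugate q) (u : Ell q K) (w : Ell p K) :
    HasSum (fun k => u k * w k) (pairing u w) := by
  have hp' : (ENNReal.ofReal p).toReal = p := ENNReal.toReal_ofReal hpq.pos.le
  have hq' : (ENNReal.ofReal q).toReal = q := ENNReal.toReal_ofReal hpq.symm.pos.le
  refine Summable.hasSum (Summable.of_norm ?_)
  simp only [norm_mul]
  exact lp.summable_mul (by rw [hp', hq']; exact hpq.symm) u w

theorem abs_pairing_le (hpq : p.HolderConjugate q) (u : Ell q K) (w : Ell p K) :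
    |pairing u w| ≤ ‖u‖ * ‖w‖ := by
  have hp' : (ENNReal.ofReal p).toReal = p := ENNReal.toReal_ofReal hpq.pos.le
  have hq' : (ENNReal.ofReal q).toReal = q := ENNReal.toReal_ofReal hpq.symm.pos.le
  have hc : (ENNReal.ofReal q).toReal.HolderConjugate (ENNReal.ofReal p).toReal := by
    rw [hp', hq']; exact hpq.symm
  refine le_trans ?_ (lp.tsum_mul_le_mul_norm' hc u w)
  have := norm_tsum_le_tsum_norm (f := fun k => u k * w k)
    (by simpa only [norm_mul] using lp.summable_mul hc u w)
  simpa only [norm_mul, Real.norm_eq_abs, pairing] using this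

theorem pairing_sub_left (hpq : p.HolderConjugate q) (u v : Ell q K) (w : Ell p K) :
    pairing (u - v) w = pairing u w - pairing v w := by
  refine (hasSum_pairing hpq _ _).unique ?_
  have h : (fun k => (u - v) k * w k) = fun k => u k * w k - v k * w k :=
    funext fun k => sub_mul (u k) (v k) (w k)
  rw [h]
  exact (hasSum_pairing hpq u w).sub (hasSum_pairing hpq v w)

theorem pairing_sub_right (hpq : p.HolderConjugate q) (u : Ell q K) (w z : Ell p K) :
    pairing u (w - z) = pairing u w - pairing u z := by
  refine (hasSum_pairing hpq _ _).unique ?_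
  have h : (fun k => u k * (w - z) k) = fun k => u k * w k - u k * z k :=
    funext fun k => mul_sub (u k) (w k) (z k)
  rw [h]
  exact (hasSum_pairing hpq u w).sub (hasSum_pairing hpq u z)

theorem pairing_smul_left (hpq : p.HolderConjugate q) (c : ℝ) (u : Ell q K) (w : Ell p K) :
    pairing (c • u) w = c * pairing u w := by
  refine (hasSum_pairing hpq _ _).unique ?_
  have h : (fun k => (c • u) k * w k) = fun k => c * (u k * w k) :=
    funext fun k => mul_assoc c (u k) (w k)
  rw [h]
  exact (hasSum_pairing hpq u w).mul_left c

/-- The gap in Young's inequality for the functions `(1/q) ‖·‖_q^q` and `(1/p) ‖·‖_p^p`. -/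
def youngGap (u : Ell q K) (w : Ell p K) : ℝ :=
  1 / p * ‖w‖ ^ p + 1 / q * ‖u‖ ^ q - pairing u w

theorem hasSum_youngGap (hpq : p.HolderConjugate q) (u : Ell q K) (w : Ell p K) :
    HasSum (fun k => 1 / p * |w k| ^ p + 1 / q * |u k| ^ q - u k * w k) (youngGap u w) :=
  (((hasSum_abs_rpow hpq.pos w).mul_left _).add
    ((hasSum_abs_rpow hpq.symm.pos u).mul_left _)).sub (hasSum_pairing hpq u w)

theorem dualityMap_apply (hpq : p.HolderConjugate q) (u : Ell q K) (k : K) :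
    dualityMap hpq u k = Real.sign (u k) * |u k| ^ (q - 1) := rfl

theorem norm_dualityMap_rpow (hpq : p.HolderConjugate q) (u : Ell q K) :
    ‖dualityMap hpq u‖ ^ p = ‖u‖ ^ q := by
  refine (hasSum_abs_rpow hpq.pos _).unique ?_
  convert hasSum_abs_rpow hpq.symm.pos u using 2 with k
  rw [dualityMap_apply, abs_sign_mul_abs_rpow_rpow hpq]

theorem pairing_dualityMap (hpq : p.HolderConjugate q) (u : Ell q K) :
    pairing u (dualityMap hpq u) = ‖u‖ ^ q := by
  refine (hasSum_pairing hpq _ _).unique ?_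
  convert hasSum_abs_rpow hpq.symm.pos u using 2 with k
  rw [dualityMap_apply, mul_sign_mul_abs_rpow hpq.symm.lt]

theorem youngGap_dualityMap (hpq : p.HolderConjugate q) (u : Ell q K) :
    youngGap u (dualityMap hpq u) = 0 := by
  have h : 1 / p + 1 / q = 1 := by simpa using hpq.inv_add_inv_eq_one
  rw [youngGap, norm_dualityMap_rpow, pairing_dualityMap, ← add_mul, h]
  ring

theorem youngGap_nonneg (hpq : p.HolderConjugate q) (hp2 : p ≤ 2) (u : Ell q K) (w : Ell p K) :
    0 ≤ youngGap u w :=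
  (hasSum_youngGap hpq u w).nonneg fun k => (sq_sub_le_young_gap hpq hp2 (w k) (u k)).2

/-- Hölder's inequality with exponents `2/p` and `2/(2-p)`, carried out as a termwise weighted AM–GM
after normalizing by `D` and `S`. This form also covers `p = 2`. -/
theorem norm_sub_dualityMap_rpow_le (hpq : p.HolderConjugate q) (hp2 : p ≤ 2) (u : Ell q K)
    (w : Ell p K) {D S : ℝ} (hD : 0 < D) (hS : 0 < S) (hgD : youngGap u w ≤ D)
    (hwS : ‖w‖ ^ p + ‖u‖ ^ q ≤ S) :
    ‖w - dualityMap hpq u‖ ^ p ≤ (2 / (p - 1) * D) ^ (p / 2) * S ^ (1 - p / 2) := by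
  have hp1 := hpq.lt
  have hc : 0 < 2 / (p - 1) := div_pos zero_lt_two (by linarith)
  set A := (2 / (p - 1) * D) ^ (p / 2) * S ^ (1 - p / 2) with hA
  have hA0 : 0 ≤ A := mul_nonneg (Real.rpow_nonneg (by positivity) _) (Real.rpow_nonneg hS.le _)
  have hsum := ((((hasSum_youngGap hpq u w).div_const D).mul_left (p / 2)).add
    ((((hasSum_abs_rpow hpq.pos w).add (hasSum_abs_rpow hpq.symm.pos u)).div_const S).mul_left
      (1 - p / 2))).mul_left A
  have hle := hasSum_le (fun k => ?_) (hasSum_abs_rpow hpq.pos (w - dualityMap hpq u)) hsum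
  · refine hle.trans (mul_le_of_le_one_right hA0 ?_)
    have h1 : youngGap u w / D ≤ 1 := (div_le_one hD).mpr hgD
    have h2 : (‖w‖ ^ p + ‖u‖ ^ q) / S ≤ 1 := (div_le_one hS).mpr hwS
    nlinarith
  · obtain ⟨h1, h2⟩ := sq_sub_le_young_gap hpq hp2 (w k) (u k)
    have h3 : (w - dualityMap hpq u) k = w k - Real.sign (u k) * |u k| ^ (q - 1) := by
      rw [← dualityMap_apply hpq]; rfl
    rw [h3]
    refine h1.trans ?_
    set g := 1 / p * |w k| ^ p + 1 / q * |u k| ^ q - u k * w k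
    set N := |w k| ^ p + |u k| ^ q with hN
    have hN0 : 0 ≤ N := add_nonneg (Real.rpow_nonneg (abs_nonneg _) _)
      (Real.rpow_nonneg (abs_nonneg _) _)
    have h4 := Real.geom_mean_le_arith_mean2_weighted (by linarith : 0 ≤ p / 2)
      (by linarith : 0 ≤ 1 - p / 2) (div_nonneg h2 hD.le) (div_nonneg hN0 hS.le) (by ring)
    refine le_trans (le_of_eq ?_) (mul_le_mul_of_nonneg_left h4 hA0)
    have e1 : 2 / (p - 1) * g = (2 / (p - 1) * D) * (g / D) := by field_simp
    have e2 : N = S * (N / S) := by field_simp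
    rw [e1]
    conv_lhs => rw [e2]
    rw [Real.mul_rpow (by positivity) (div_nonneg h2 hD.le),
      Real.mul_rpow hS.le (div_nonneg hN0 hS.le), hA]
    ring

/-- On bounded sets the squared distance to the duality map is controlled by the Young gap. -/
theorem exists_sq_norm_sub_dualityMap_le (hpq : p.HolderConjugate q) (hp2 : p ≤ 2) (B : ℝ) :
    ∃ C : ℝ, 0 < C ∧ ∀ (u : Ell q K) (w : Ell p K), ‖u‖ ≤ B → ‖w‖ ≤ B →
      ‖w - dualityMap hpq u‖ ^ 2 ≤ C * youngGap u w := by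
  have hp1 := hpq.lt
  have hc : 0 < 2 / (p - 1) := div_pos zero_lt_two (by linarith)
  set S := |B| ^ p + |B| ^ q + 1 with hSdef
  have hS : 0 < S := by positivity
  refine ⟨2 / (p - 1) * S ^ ((1 - p / 2) * (2 / p)),
    mul_pos hc (Real.rpow_pos_of_pos hS _), fun u w hu hw => ?_⟩
  have hu0 : 0 ≤ ‖u‖ := lp.norm_nonneg' _
  have hw0 : 0 ≤ ‖w‖ := lp.norm_nonneg' _
  have hwS : ‖w‖ ^ p + ‖u‖ ^ q ≤ S := by
    have h1 := Real.rpow_le_rpow hw0 (hw.trans (le_abs_self B)) hpq.pos.le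
    have h2 := Real.rpow_le_rpow hu0 (hu.trans (le_abs_self B)) hpq.symm.pos.le
    linarith
  have key : ∀ D : ℝ, 0 < D → youngGap u w ≤ D →
      ‖w - dualityMap hpq u‖ ^ 2 ≤ 2 / (p - 1) * S ^ ((1 - p / 2) * (2 / p)) * D := by
    intro D hD hgD
    have h1 := norm_sub_dualityMap_rpow_le hpq hp2 u w hD hS hgD hwS
    have hd0 : 0 ≤ ‖w - dualityMap hpq u‖ := lp.norm_nonneg' _
    have h2 := Real.rpow_le_rpow (Real.rpow_nonneg hd0 _) h1
      (by have := hpq.pos; positivity : 0 ≤ 2 / p)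
    have hp0 := hpq.pos.ne'
    rw [← Real.rpow_mul hd0, Real.mul_rpow (Real.rpow_nonneg (by positivity) _)
      (Real.rpow_nonneg hS.le _), ← Real.rpow_mul (by positivity), ← Real.rpow_mul hS.le] at h2
    have e1 : p * (2 / p) = (2 : ℕ) := by field_simp; norm_num
    have e2 : p / 2 * (2 / p) = 1 := by field_simp
    rw [e1, e2, Real.rpow_natCast, Real.rpow_one] at h2
    linarith
  refine le_of_forall_pos_le_add fun ε hε => ?_
  set C := 2 / (p - 1) * S ^ ((1 - p / 2) * (2 / p)) with hC
  have hC0 : 0 < C := mul_pos hc (Real.rpow_pos_of_pos hS _)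
  -- The gap may be zero while `D` must be positive; the excess `ε / C` costs exactly `ε`.
  have := key (youngGap u w + ε / C)
    (add_pos_of_nonneg_of_pos (youngGap_nonneg hpq hp2 u w) (div_pos hε hC0))
    (by linarith [div_pos hε hC0])
  rwa [mul_add, mul_div_cancel₀ _ hC0.ne'] at this

/-- The gap of `v` against `J_q u` is the Bregman distance of `‖·‖_q^q / q`; this is its
symmetrization. -/
theorem youngGap_symm_add (hpq : p.HolderConjugate q) (u v : Ell q K) :
    youngGap v (dualityMap hpq u) + youngGap u (dualityMap hpq v) =
      pairing (v - u) (dualityMap hpq v - dualityMap hpq u) := by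
  have h1 := youngGap_dualityMap hpq u
  have h2 := youngGap_dualityMap hpq v
  rw [pairing_sub_right hpq, pairing_sub_left hpq, pairing_sub_left hpq]
  simp only [youngGap] at *
  linarith

/-- The duality map is Lipschitz on bounded sets; stated through the Young gap. -/
theorem exists_youngGap_dualityMap_le (hpq : p.HolderConjugate q) (hp2 : p ≤ 2) (B : ℝ) :
    ∃ C : ℝ, 0 ≤ C ∧ ∀ u v : Ell q K, ‖u‖ ≤ B → ‖v‖ ≤ B →
      youngGap v (dualityMap hpq u) ≤ C * ‖v - u‖ ^ 2 := by
  have : Fact (1 ≤ ENNReal.ofReal p) := ⟨by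
    rw [← ENNReal.ofReal_one]; exact ENNReal.ofReal_le_ofReal hpq.lt.le⟩
  set B' := max B (|B| ^ (q / p)) with hB'
  obtain ⟨C, hC, h⟩ := exists_sq_norm_sub_dualityMap_le (K := K) hpq hp2 B'
  refine ⟨C, hC.le, fun u v hu hv => ?_⟩
  have hJ : ∀ u : Ell q K, ‖u‖ ≤ B → ‖dualityMap hpq u‖ ≤ B' := by
    intro u hu
    refine le_trans ?_ (le_max_right _ _)
    have hu0 : 0 ≤ ‖u‖ := lp.norm_nonneg' _
    rw [← Real.rpow_le_rpow_iff (lp.norm_nonneg' _) (Real.rpow_nonneg (abs_nonneg _) _) hpq.pos,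
      norm_dualityMap_rpow, ← Real.rpow_mul (abs_nonneg _), div_mul_cancel₀ _ hpq.pos.ne']
    exact Real.rpow_le_rpow hu0 (hu.trans (le_abs_self _)) hpq.symm.pos.le
  have h1 := h v (dualityMap hpq u) (hv.trans (le_max_left _ _)) (hJ u hu)
  have h3 := youngGap_symm_add hpq u v
  have h4 := (le_abs_self _).trans
    (abs_pairing_le hpq (v - u) (dualityMap hpq v - dualityMap hpq u))
  have h5 := youngGap_nonneg hpq hp2 u (dualityMap hpq v)
  rw [norm_sub_rev] at h1
  set d := ‖dualityMap hpq v - dualityMap hpq u‖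
  set e := ‖v - u‖
  have hd : 0 ≤ d := lp.norm_nonneg' _
  have he : 0 ≤ e := lp.norm_nonneg' _
  -- The symmetrized identity bounds the gap by `e d`, while `d² ≤ C · gap`; hence `d ≤ C e`, and
  -- the gap is at most `C e²`.
  have h6 : d ≤ C * e := by
    rcases hd.eq_or_lt with h0 | h0
    · rw [← h0]; positivity
    · have : d * d ≤ C * e * d := by nlinarith
      exact le_of_mul_le_mul_right this h0
  nlinarith

end

end Lp

end DualLp

namespace DualLp

noncomputable section

/-! ### Extended-valued convexity and minimization. -/

section EReal

variable {V : Type*}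

theorem EConvex.convexOn_toReal [AddCommGroup V] [Module ℝ V] {f : V → EReal}
    (hf : EConvex f) (hbot : ∀ v, f v ≠ ⊥) :
    ConvexOn ℝ {v | f v ≠ ⊤} fun v => (f v).toReal := by
  have key : ∀ u v : V, f u ≠ ⊤ → f v ≠ ⊤ → ∀ t : ℝ, 0 < t → t < 1 →
      f (t • u + (1 - t) • v) ≤ ((t * (f u).toReal + (1 - t) * (f v).toReal : ℝ) : EReal) := by
    intro u v hu hv t ht ht'
    refine (hf u v t ht ht').trans (le_of_eq ?_)
    conv_lhs => rw [← EReal.coe_toReal hu (hbot u), ← EReal.coe_toReal hv (hbot v)]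
    norm_cast
  have key' : ∀ u v : V, f u ≠ ⊤ → f v ≠ ⊤ → ∀ a b : ℝ, 0 ≤ a → 0 ≤ b → a + b = 1 →
      f (a • u + b • v) ≤ ((a * (f u).toReal + b * (f v).toReal : ℝ) : EReal) := by
    intro u v hu hv a b ha hb hab
    rcases ha.eq_or_lt with rfl | ha
    · obtain rfl : b = 1 := by linarith
      simp [EReal.coe_toReal hv (hbot v)]
    rcases hb.eq_or_lt with rfl | hb
    · obtain rfl : a = 1 := by linarith
      simp [EReal.coe_toReal hu (hbot u)]
    obtain rfl : b = 1 - a := by linarith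
    exact key u v hu hv a ha (by linarith)
  refine ⟨?_, ?_⟩
  · intro u hu v hv a b ha hb hab
    exact ne_top_of_le_ne_top (EReal.coe_ne_top _) (key' u v hu hv a b ha hb hab)
  · intro u hu v hv a b ha hb hab
    have h := key' u v hu hv a b ha hb hab
    have h' := ne_top_of_le_ne_top (EReal.coe_ne_top _) h
    rw [← EReal.coe_toReal h' (hbot _), EReal.coe_le_coe_iff] at h
    exact h

theorem LowerSemicontinuous.exists_isMinOn_of_coercive {n : ℕ} {f : E n → EReal}
    (hf : LowerSemicontinuous f) {v₀ : E n} (hv₀ : f v₀ ≠ ⊤) {B : ℝ}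
    (hB : ∀ v, ((‖v‖ - B : ℝ) : EReal) ≤ f v) : ∃ u, IsMinOn f Set.univ u := by
  have hbot : f v₀ ≠ ⊥ := fun h => by
    have := hB v₀
    rw [h, le_bot_iff] at this
    exact EReal.coe_ne_bot _ this
  set R := (f v₀).toReal + B with hR
  have hmem : v₀ ∈ Metric.closedBall (0 : E n) R := by
    have := hB v₀
    rw [← EReal.coe_toReal hv₀ hbot, EReal.coe_le_coe_iff] at this
    rw [mem_closedBall_zero_iff]
    linarith
  obtain ⟨u, -, hu⟩ := (hf.lowerSemicontinuousOn _).exists_isMinOn ⟨v₀, hmem⟩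
    (isCompact_closedBall (0 : E n) R)
  refine ⟨u, fun v _ => ?_⟩
  by_cases hv : v ∈ Metric.closedBall (0 : E n) R
  · exact hu hv
  · refine (hu hmem).trans (le_trans ?_ (hB v))
    rw [mem_closedBall_zero_iff, not_le] at hv
    rw [← EReal.coe_toReal hv₀ hbot, EReal.coe_le_coe_iff]
    linarith

theorem lowerSemicontinuous_add_coe [TopologicalSpace V] {f : V → EReal}
    (hf : LowerSemicontinuous f) {g : V → ℝ} (hg : Continuous g) :
    LowerSemicontinuous fun v => f v + (g v : EReal) :=
  hf.add' (continuous_coe_real_ereal.comp hg).lowerSemicontinuous fun _ =>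
    EReal.continuousAt_add (Or.inr (EReal.coe_ne_bot _)) (Or.inr (EReal.coe_ne_top _))

/-- First order optimality condition for the sum of a convex and a differentiable function. -/
theorem le_add_of_isMinOn_add [AddCommGroup V] [Module ℝ V] {D : Set V} {ψ g : V → ℝ}
    (hψ : ConvexOn ℝ D ψ) {u x : V} (hu : u ∈ D) (hx : x ∈ D) {c : ℝ}
    (hg : HasDerivAt (fun t : ℝ => g (u + t • (x - u))) c 0)
    (hmin : ∀ v ∈ D, ψ u + g u ≤ ψ v + g v) : ψ u ≤ ψ x + c := by
  have h1 := hg.hasDerivWithinAt (s := Set.Ioi 0)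
  rw [hasDerivWithinAt_iff_tendsto_slope' (by simp)] at h1
  have h2 : ψ u - ψ x ≤ c := by
    -- Minimality and convexity on the segment bound every difference quotient of `g` below by `ψ u
    -- - ψ x`.
    refine ge_of_tendsto h1 ?_
    filter_upwards [Ioo_mem_nhdsGT (zero_lt_one (α := ℝ))] with t ht
    have hv : u + t • (x - u) = (1 - t) • u + t • x := by module
    have h3 := hψ.2 hu hx (by linarith [ht.2] : 0 ≤ 1 - t) ht.1.le (by ring)
    have h4 := hmin _ (hψ.1 hu hx (by linarith [ht.2] : 0 ≤ 1 - t) ht.1.le (by ring))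
    simp only [slope_def_field, zero_smul, add_zero, sub_zero]
    rw [le_div_iff₀ ht.1, hv]
    simp only [smul_eq_mul] at h3
    nlinarith
  linarith

end EReal

/-! ### Proximity operator. -/

section Prox

variable {n : ℕ} {f : E n → EReal} {r : ℝ} {z u : E n}

theorem IsProx.ne_top (hf : EProper f) (h : IsProx r f z u) : f u ≠ ⊤ := by
  obtain ⟨v, hv⟩ := hf.2
  have h1 : f u + ((1 / (2 * r) * ‖u - z‖ ^ 2 : ℝ) : EReal) ≤
      f v + ((1 / (2 * r) * ‖v - z‖ ^ 2 : ℝ) : EReal) := h (Set.mem_univ v)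
  intro hu
  rw [hu, EReal.top_add_coe, top_le_iff] at h1
  exact (EReal.add_lt_top hv (EReal.coe_ne_top _)).ne h1

/-- Variational inequality of the proximity operator. -/
theorem IsProx.le_toReal (hf : EProper f) (hc : EConvex f) (hr : 0 < r) (h : IsProx r f z u)
    {x : E n} (hx : f x ≠ ⊤) :
    (f u).toReal + 1 / r * inner ℝ (x - u) (z - u) ≤ (f x).toReal := by
  have hu := h.ne_top hf
  have hg : HasDerivAt (fun t : ℝ => 1 / (2 * r) * ‖u + t • (x - u) - z‖ ^ 2)
      (-(1 / r * inner ℝ (x - u) (z - u))) 0 := by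
    have h1 : (fun t : ℝ => 1 / (2 * r) * ‖u + t • (x - u) - z‖ ^ 2) = fun t : ℝ =>
        1 / (2 * r) * (‖u - z‖ ^ 2 + t * (-2 * inner ℝ (x - u) (z - u)) + t ^ 2 * ‖x - u‖ ^ 2) := by
      funext t
      have e : u + t • (x - u) - z = (u - z) + t • (x - u) := by abel
      have e' : inner ℝ (u - z) (x - u) = - inner ℝ (x - u) (z - u) := by
        rw [← inner_neg_right, neg_sub, real_inner_comm]
      rw [e, norm_add_sq_real, inner_smul_right, e', norm_smul, mul_pow, Real.norm_eq_abs, sq_abs]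
      ring
    rw [h1]
    have h2 := (((hasDerivAt_id (0 : ℝ)).mul_const (-2 * inner ℝ (x - u) (z - u))).const_add
      (‖u - z‖ ^ 2)).add ((hasDerivAt_pow 2 (0 : ℝ)).mul_const (‖x - u‖ ^ 2))
    refine (h2.const_mul (1 / (2 * r))).congr_deriv ?_
    simp
    field_simp
  have := le_add_of_isMinOn_add (hc.convexOn_toReal hf.1) hu hx
    (g := fun v => 1 / (2 * r) * ‖v - z‖ ^ 2) hg fun v hv => ?_
  · linarith
  · have h1 : f u + ((1 / (2 * r) * ‖u - z‖ ^ 2 : ℝ) : EReal) ≤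
      f v + ((1 / (2 * r) * ‖v - z‖ ^ 2 : ℝ) : EReal) := h (Set.mem_univ v)
    rw [← EReal.coe_toReal hu (hf.1 u), ← EReal.coe_toReal hv (hf.1 v)] at h1
    exact_mod_cast h1

/-- Adding the two inequalities gives `‖u - u'‖² ≤ ⟨u - u', z - z'⟩`. Only variational inequalities
are assumed, so that a dual minimizer can play the role of a proximity point. -/
theorem norm_sub_le_of_variational {ψ : E n → ℝ} (hr : 0 < r) {z' u' : E n}
    (h : ψ u + 1 / r * inner ℝ (u' - u) (z - u) ≤ ψ u')
    (h' : ψ u' + 1 / r * inner ℝ (u - u') (z' - u') ≤ ψ u) : ‖u - u'‖ ≤ ‖z - z'‖ := by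
  have h1 : 1 / r * (inner ℝ (u' - u) (z - u) + inner ℝ (u - u') (z' - u')) ≤ 0 := by linarith
  have h2 : inner ℝ (u' - u) (z - u) + inner ℝ (u - u') (z' - u') ≤ 0 := by
    by_contra hlt
    have := mul_pos (one_div_pos.mpr hr) (not_le.mp hlt)
    linarith
  have h3 : inner ℝ (u' - u) (z - u) + inner ℝ (u - u') (z' - u') =
      ‖u - u'‖ ^ 2 - inner ℝ (u - u') (z - z') := by
    rw [← real_inner_self_eq_norm_sq, ← neg_sub u u', inner_neg_left, neg_add_eq_sub,
      ← inner_sub_right, ← inner_sub_right]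
    congr 1; abel
  have h4 := real_inner_le_norm (u - u') (z - z')
  rcases (norm_nonneg (u - u')).eq_or_lt with h0 | h0
  · rw [← h0]; exact norm_nonneg _
  · refine le_of_mul_le_mul_left ?_ h0
    nlinarith

theorem IsProx.unique (hf : EProper f) (hc : EConvex f) (hr : 0 < r) (h : IsProx r f z u)
    {u' : E n} (h' : IsProx r f z u') : u = u' := by
  have := norm_sub_le_of_variational (ψ := fun v => (f v).toReal) hr
    (h.le_toReal hf hc hr (h'.ne_top hf)) (h'.le_toReal hf hc hr (h.ne_top hf))
  rw [sub_self, norm_zero] at this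
  exact sub_eq_zero.mp (norm_le_zero_iff.mp this)

/-- A lower semicontinuous function with an affine minorant has proximity points. -/
theorem exists_isProx (hf : EProper f) (hlsc : LowerSemicontinuous f) {a g : E n} {c : ℝ}
    (hg : ∀ v, f v ≠ ⊤ → c + inner ℝ (v - a) g ≤ (f v).toReal) (hr : 0 < r) (z : E n) :
    ∃ u, IsProx r f z u := by
  obtain ⟨v₀, hv₀⟩ := hf.2
  refine LowerSemicontinuous.exists_isMinOn_of_coercive (v₀ := v₀)
    (B := ‖z‖ - c + ‖g‖ * ‖z - a‖ + r / 2 * (‖g‖ + 1) ^ 2)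
    (lowerSemicontinuous_add_coe hlsc (by fun_prop)) ?_ fun v => ?_
  · exact (EReal.add_lt_top hv₀ (EReal.coe_ne_top _)).ne
  · by_cases hv : f v = ⊤
    · rw [hv, EReal.top_add_coe]; exact le_top
    rw [← EReal.coe_toReal hv (hf.1 v), ← EReal.coe_add, EReal.coe_le_coe_iff]
    have h1 := hg v hv
    have h2 := abs_le.mp (abs_real_inner_le_norm (v - a) g)
    have h3 : ‖v - a‖ ≤ ‖v - z‖ + ‖z - a‖ := norm_sub_le_norm_sub_add_norm_sub _ _ _
    have h4 : ‖v‖ ≤ ‖v - z‖ + ‖z‖ := by simpa using norm_add_le (v - z) z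
    -- The slope `‖g‖` absorbs the affine minorant; the extra 1 supplies the linear growth required
    -- for coercivity.
    have h5 : (‖g‖ + 1) * ‖v - z‖ ≤ 1 / (2 * r) * ‖v - z‖ ^ 2 + r / 2 * (‖g‖ + 1) ^ 2 := by
      have : 1 / (2 * r) * ‖v - z‖ ^ 2 + r / 2 * (‖g‖ + 1) ^ 2 - (‖g‖ + 1) * ‖v - z‖ =
          1 / (2 * r) * (‖v - z‖ - r * (‖g‖ + 1)) ^ 2 := by field_simp; ring
      have h0 : 0 ≤ 1 / (2 * r) * (‖v - z‖ - r * (‖g‖ + 1)) ^ 2 := by positivity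
      linarith
    have h6 := mul_le_mul_of_nonneg_left h3 (norm_nonneg g)
    nlinarith

end Prox

/-! ### Convex functions with locally Lipschitz gradient. -/

section Smooth

variable {n : ℕ} {φ : E n → ℝ}

theorem hasDerivAt_comp_line (hd : Differentiable ℝ φ) (a d : E n) :
    HasDerivAt (fun t : ℝ => φ (a + t • d)) (inner ℝ d (gradient φ a)) 0 := by
  have h1 : HasFDerivAt φ (fderiv ℝ φ a) (a + (0 : ℝ) • d) := by
    simpa using (hd a).hasFDerivAt
  have h2 : HasDerivAt (fun t : ℝ => a + t • d) ((1 : ℝ) • d) 0 :=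
    ((hasDerivAt_id (0 : ℝ)).smul_const d).const_add a
  have h3 := h1.comp_hasDerivAt (0 : ℝ) h2
  rw [one_smul] at h3
  rw [real_inner_comm, inner_gradient_left]
  exact h3

theorem add_inner_gradient_le (hc : ConvexOn ℝ Set.univ φ) (hd : Differentiable ℝ φ) (a x : E n) :
    φ a + inner ℝ (x - a) (gradient φ a) ≤ φ x := by
  have h1 := (hasDerivAt_comp_line hd a (x - a)).neg
  -- `φ + (-φ)` is constant, so every point minimizes it, and the optimality condition becomes the
  -- gradient inequality.
  have := le_add_of_isMinOn_add (g := fun v => - φ v) hc (Set.mem_univ a) (Set.mem_univ x)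
    h1 (by intro v _; simp)
  linarith

theorem exists_lipschitz_gradient_closedBall (hL : LocallyLipschitz (gradient φ)) (a : E n)
    (R : ℝ) : ∃ M : ℝ, 0 ≤ M ∧ ∀ u ∈ Metric.closedBall a R, ∀ v ∈ Metric.closedBall a R,
      ‖gradient φ u - gradient φ v‖ ≤ M * ‖u - v‖ := by
  obtain ⟨M, hM⟩ :=
    (hL.locallyLipschitzOn (s := Metric.closedBall a R)).exists_lipschitzOnWith_of_compact
      (isCompact_closedBall a R)
  exact ⟨M, M.2, fun u hu v hv => hM.norm_sub_le hu hv⟩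

/-- The gradient inequality at `u` bounds the error by `⟨u - a, ∇φ(u) - ∇φ(a)⟩`. Avoiding
integration costs a factor 2, which is harmless here. -/
theorem linearization_error_le (hc : ConvexOn ℝ Set.univ φ) (hd : Differentiable ℝ φ) {a u : E n}
    {M : ℝ} (hM : ‖gradient φ u - gradient φ a‖ ≤ M * ‖u - a‖) :
    φ u - φ a - inner ℝ (u - a) (gradient φ a) ≤ M * ‖u - a‖ ^ 2 := by
  have h1 := add_inner_gradient_le hc hd u a
  have h2 := real_inner_le_norm (u - a) (gradient φ u - gradient φ a)
  rw [inner_sub_right] at h2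
  rw [← neg_sub u a, inner_neg_left] at h1
  have h3 := mul_le_mul_of_nonneg_left hM (norm_nonneg (u - a))
  nlinarith

end Smooth

/-! ### Rates for real sequences. -/

section Sequences

/-- By monotonicity `m e_m` is at most twice the block sum over `[m/2, m)`, which tends to 0. -/
theorem tendsto_mul_of_antitone_summable {e : ℕ → ℝ} (he : Antitone e) (h0 : ∀ m, 0 ≤ e m)
    (hs : Summable e) : Tendsto (fun m : ℕ => (m : ℝ) * e m) atTop (𝓝 0) := by
  have h1 := hs.hasSum.tendsto_sum_nat
  have h2 := h1.comp (tendsto_atTop_atTop.mpr fun b => ⟨2 * b, fun a ha => by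
    show b ≤ a / 2; omega⟩ : Tendsto (fun m : ℕ => m / 2) atTop atTop)
  have h3 := (h1.sub h2).const_mul 2
  rw [sub_self, mul_zero] at h3
  refine squeeze_zero (fun m => mul_nonneg (Nat.cast_nonneg _) (h0 m)) (fun m => ?_) h3
  simp only [Function.comp_apply]
  rw [← Finset.sum_Ico_eq_sub _ (Nat.div_le_self m 2)]
  have h4 : (Finset.Ico (m / 2) m).card • e m ≤ ∑ k ∈ Finset.Ico (m / 2) m, e k :=
    Finset.card_nsmul_le_sum _ _ _ fun k hk => he (Finset.mem_Ico.mp hk).2.le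
  rw [Nat.card_Ico, nsmul_eq_mul] at h4
  have h5 : (m : ℝ) ≤ 2 * ((m - m / 2 : ℕ) : ℝ) := by
    have : m ≤ 2 * (m - m / 2) := by omega
    exact_mod_cast this
  have := mul_le_mul_of_nonneg_right h5 (h0 m)
  linarith

theorem isLittleO_one_div_sqrt {d e : ℕ → ℝ} {C : ℝ} (hd : ∀ m, 0 ≤ d m) (he : Antitone e)
    (h0 : ∀ m, 0 ≤ e m) (hs : Summable e) (hde : ∀ m, d (m + 1) ^ 2 ≤ C * e m) :
    d =o[atTop] fun m : ℕ => 1 / √(m : ℝ) := by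
  have h1 : Tendsto (fun m : ℕ => C * ((m : ℝ) * e m + e m)) atTop (𝓝 0) := by
    simpa using ((tendsto_mul_of_antitone_summable he h0 hs).add
      hs.tendsto_atTop_zero).const_mul C
  have h2 : Tendsto (fun m : ℕ => (d (m + 1) * √((m + 1 : ℕ) : ℝ)) ^ 2) atTop (𝓝 0) := by
    refine squeeze_zero (fun m => sq_nonneg _) (fun m => ?_) h1
    rw [mul_pow, Real.sq_sqrt (Nat.cast_nonneg _)]
    push_cast
    have := mul_le_mul_of_nonneg_right (hde m) (by positivity : (0 : ℝ) ≤ m + 1)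
    linarith
  have h3 : Tendsto (fun m : ℕ => d (m + 1) * √((m + 1 : ℕ) : ℝ)) atTop (𝓝 0) := by
    have := h2.sqrt
    rw [Real.sqrt_zero] at this
    refine this.congr fun m => Real.sqrt_sq (mul_nonneg (hd _) (Real.sqrt_nonneg _))
  have h4 : Tendsto (fun m : ℕ => d m * √(m : ℝ)) atTop (𝓝 0) :=
    (tendsto_add_atTop_iff_nat (f := fun m : ℕ => d m * √(m : ℝ)) 1).mp h3
  rw [isLittleO_iff_tendsto' ]
  · simpa using h4
  · filter_upwards [eventually_gt_atTop 0] with m hm h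
    have : 0 < √(m : ℝ) := Real.sqrt_pos.mpr (by exact_mod_cast hm)
    exact absurd h (one_div_pos.mpr this).ne'

/-- The hypotheses give `(1 + b/c) V_{m+1} ≤ V_m`. The rate for `d` is the square root of the ratio
`c / (c + b)`, since `d²` is what `V` controls. -/
theorem exists_linear_rate {d e V : ℕ → ℝ} {C b c : ℝ} (hd : ∀ m, 0 ≤ d m)
    (hde : ∀ m, d (m + 1) ^ 2 ≤ C * e m) (hC : 0 ≤ C) (hb : 0 < b) (hc : 0 < c)
    (hV : ∀ m, V (m + 1) + b * e (m + 1) ≤ V m) (hVe : ∀ m, V m ≤ c * e m)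
    (hV0 : ∀ m, 0 ≤ V m) :
    ∃ C ρ : ℝ, 0 < ρ ∧ ρ < 1 ∧ ∀ m : ℕ, d m ≤ C * ρ ^ m := by
  set σ := c / (c + b) with hσ
  have hσ0 : 0 < σ := by positivity
  have hσ1 : σ < 1 := (div_lt_one (by positivity)).mpr (by linarith)
  have hstep : ∀ m, V (m + 1) ≤ σ * V m := by
    intro m
    have h1 := hV m
    have h2 := hVe (m + 1)
    rw [hσ, div_mul_eq_mul_div, le_div_iff₀ (by positivity)]
    nlinarith
  have hgeo : ∀ m, V m ≤ V 0 * σ ^ m := by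
    intro m
    induction m with
    | zero => simp
    | succ k ih =>
      calc V (k + 1) ≤ σ * V k := hstep k
        _ ≤ σ * (V 0 * σ ^ k) := mul_le_mul_of_nonneg_left ih hσ0.le
        _ = _ := by ring
  have hd2 : ∀ m, d (m + 2) ≤ √(C * (V 0 / b)) * √σ ^ m := by
    intro m
    rw [← Real.sqrt_eq_iff_mul_self_eq_of_pos (by positivity) |>.mpr (rfl : √σ ^ m * √σ ^ m = _),
      ← Real.sqrt_mul (by have := hV0 0; positivity), ← mul_pow, Real.mul_self_sqrt hσ0.le]
    refine Real.le_sqrt_of_sq_le ((hde (m + 1)).trans ?_)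
    have h1 : e (m + 1) ≤ V m / b := by
      rw [le_div_iff₀ hb]; linarith [hV m, hV0 (m + 1)]
    have h2 : V m / b ≤ V 0 * σ ^ m / b := div_le_div_of_nonneg_right (hgeo m) hb.le
    calc C * e (m + 1) ≤ C * (V 0 * σ ^ m / b) := mul_le_mul_of_nonneg_left (h1.trans h2) hC
      _ = _ := by ring
  set ρ := √σ with hρ
  have hρ0 : 0 < ρ := Real.sqrt_pos.mpr hσ0
  have hρ1 : ρ < 1 := by rw [hρ, Real.sqrt_lt' one_pos]; simpa using hσ1
  set A := √(C * (V 0 / b))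
  have hA : 0 ≤ A := Real.sqrt_nonneg _
  -- The geometric bound starts at index 2; the first two terms of the constant cover `d 0` and `d
  -- 1`.
  refine ⟨d 0 + d 1 / ρ + A / ρ ^ 2, ρ, hρ0, hρ1, fun m => ?_⟩
  have h0 := hd 0
  have h1 := hd 1
  have hAρ : 0 ≤ A / ρ ^ 2 := by positivity
  have h1ρ : 0 ≤ d 1 / ρ := by positivity
  match m with
  | 0 => simp only [pow_zero, mul_one]; linarith
  | 1 =>
    have : d 1 / ρ * ρ = d 1 := div_mul_cancel₀ _ hρ0.ne'
    rw [pow_one]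
    nlinarith [mul_nonneg h0 hρ0.le, mul_nonneg hAρ hρ0.le]
  | m + 2 =>
    have h2 : A / ρ ^ 2 * ρ ^ (m + 2) = A * ρ ^ m := by
      rw [pow_add]; field_simp
    have h3 : 0 < ρ ^ (m + 2) := pow_pos hρ0 _
    have := hd2 m
    nlinarith [mul_nonneg h0 h3.le, mul_nonneg h1ρ h3.le]

end Sequences

/-! ### Proximal gradient method with backtracking. -/

section Algorithm

variable {n : ℕ} {φ₁ : E n → ℝ} {φ₂ : E n → EReal} {δ θ lamBar : ℝ}

/-- A minimizer of `φ₁ + φ₂` satisfies the first order condition `-∇φ₁ ∈ ∂φ₂`. -/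
theorem sub_inner_gradient_le (hd : Differentiable ℝ φ₁) (h2 : EProper φ₂) (h2c : EConvex φ₂)
    {abar : E n} (habar : φ₂ abar ≠ ⊤)
    (hmin : ∀ v, φ₂ v ≠ ⊤ → φ₁ abar + (φ₂ abar).toReal ≤ φ₁ v + (φ₂ v).toReal)
    {x : E n} (hx : φ₂ x ≠ ⊤) :
    (φ₂ abar).toReal + inner ℝ (x - abar) (-gradient φ₁ abar) ≤ (φ₂ x).toReal := by
  have := le_add_of_isMinOn_add (h2c.convexOn_toReal h2.1) habar hx (g := φ₁)
    (hasDerivAt_comp_line hd abar (x - abar)) fun v hv => by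
      have := hmin v hv; linarith
  rw [inner_neg_right]
  linarith

/-- The basic inequality of the proximal gradient step. -/
theorem prox_grad_step_le (h1c : ConvexOn ℝ Set.univ φ₁) (hd : Differentiable ℝ φ₁)
    (h2 : EProper φ₂) (h2c : EConvex φ₂) {r : ℝ} (hr : 0 < r) {a u : E n}
    (hu : IsProx r φ₂ (a - r • gradient φ₁ a) u)
    (ht : φ₁ u - φ₁ a - inner ℝ (u - a) (gradient φ₁ a) ≤ δ / r * ‖u - a‖ ^ 2)
    {x : E n} (hx : φ₂ x ≠ ⊤) :
    2 * r * ((φ₁ u + (φ₂ u).toReal) - (φ₁ x + (φ₂ x).toReal)) ≤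
      ‖x - a‖ ^ 2 - ‖x - u‖ ^ 2 + (2 * δ - 1) * ‖u - a‖ ^ 2 := by
  have e1 := hu.le_toReal h2 h2c hr hx
  have e2 := add_inner_gradient_le h1c hd a x
  set g := gradient φ₁ a
  have e3 : inner ℝ (x - u) (a - r • g - u) = inner ℝ (x - u) (a - u) - r * inner ℝ (x - u) g := by
    rw [sub_right_comm, inner_sub_right, inner_smul_right]
  have e4 : inner ℝ (x - u) g = inner ℝ (x - a) g - inner ℝ (u - a) g := by
    rw [← inner_sub_left]; congr 1; abel
  have e5 : 2 * inner ℝ (x - u) (a - u) = ‖x - u‖ ^ 2 + ‖u - a‖ ^ 2 - ‖x - a‖ ^ 2 := by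
    have h := norm_sub_sq_real (x - u) (a - u)
    rw [sub_sub_sub_cancel_right, norm_sub_rev a u] at h
    linarith
  rw [e3] at e1
  have e6 : r * (1 / r * (inner ℝ (x - u) (a - u) - r * inner ℝ (x - u) g)) =
      inner ℝ (x - u) (a - u) - r * inner ℝ (x - u) g := by field_simp
  have e7 := mul_le_mul_of_nonneg_left e1 hr.le
  have e8 := mul_le_mul_of_nonneg_left ht hr.le
  have e9 : r * (δ / r * ‖u - a‖ ^ 2) = δ * ‖u - a‖ ^ 2 := by field_simp
  have e10 := mul_le_mul_of_nonneg_left e2 hr.le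
  rw [mul_add, e6, e4] at e7
  rw [e9] at e8
  linarith

/-- All sufficiently small stepsizes pass the linesearch test, uniformly on bounded sets. -/
theorem exists_linesearchTest (h1c : ConvexOn ℝ Set.univ φ₁) (hd : Differentiable ℝ φ₁)
    (hL : LocallyLipschitz (gradient φ₁)) (h2 : EProper φ₂) (h2l : LowerSemicontinuous φ₂)
    (h2c : EConvex φ₂) {abar : E n} (habar : φ₂ abar ≠ ⊤)
    (hmin : ∀ v, φ₂ v ≠ ⊤ → φ₁ abar + (φ₂ abar).toReal ≤ φ₁ v + (φ₂ v).toReal)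
    (hδ : 0 < δ) (R : ℝ) :
    ∃ r₀ : ℝ, 0 < r₀ ∧ ∀ a, ‖a - abar‖ ≤ R → ∀ r, 0 < r → r ≤ r₀ → LinesearchTest φ₁ φ₂ δ a r := by
  obtain ⟨M, hM, hMlip⟩ := exists_lipschitz_gradient_closedBall hL abar R
  obtain ⟨M', hM', hMlip'⟩ := exists_lipschitz_gradient_closedBall hL abar (R + M * R)
  refine ⟨min 1 (δ / (M' + 1)), lt_min one_pos (by positivity), fun a ha r hr hrr => ?_⟩
  have hR : 0 ≤ R := (norm_nonneg _).trans ha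
  have hmin' := fun x hx => sub_inner_gradient_le (x := x) hd h2 h2c habar hmin hx
  obtain ⟨u, hu⟩ := exists_isProx h2 h2l hmin' hr (a - r • gradient φ₁ a)
  refine ⟨u, hu, ?_⟩
  -- `abar` is a fixed point of the proximal gradient map for every stepsize. Nonexpansiveness then
  -- keeps `u` in a ball whose radius does not depend on `r ≤ 1`, where one Lipschitz constant `M'`
  -- serves.
  have h1 : ‖u - abar‖ ≤ ‖(a - r • gradient φ₁ a) - (abar - r • gradient φ₁ abar)‖ := by
    refine norm_sub_le_of_variational (ψ := fun v => (φ₂ v).toReal) hr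
      (hu.le_toReal h2 h2c hr habar) ?_
    have h := hmin' u (hu.ne_top h2)
    have e : abar - r • gradient φ₁ abar - abar = r • (-gradient φ₁ abar) := by
      rw [smul_neg]; abel
    rw [e, inner_smul_right, one_div, inv_mul_cancel_left₀ hr.ne']
    exact h
  have haR : a ∈ Metric.closedBall abar R := by rwa [mem_closedBall_iff_norm]
  have h2' : ‖(a - r • gradient φ₁ a) - (abar - r • gradient φ₁ abar)‖ ≤ R + M * R := by
    have e : (a - r • gradient φ₁ a) - (abar - r • gradient φ₁ abar) =
        (a - abar) - r • (gradient φ₁ a - gradient φ₁ abar) := by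
      rw [smul_sub]; abel
    rw [e]
    refine (norm_sub_le _ _).trans (add_le_add ha ?_)
    rw [norm_smul, Real.norm_eq_abs, abs_of_pos hr]
    have h3 := hMlip a haR abar (Metric.mem_closedBall_self hR)
    have h4 : r ≤ 1 := hrr.trans (min_le_left _ _)
    have h5 := mul_le_mul_of_nonneg_left ha hM
    calc r * _ ≤ 1 * _ := mul_le_mul_of_nonneg_right h4 (norm_nonneg _)
      _ ≤ M * R := by linarith
  have huR : u ∈ Metric.closedBall abar (R + M * R) := by
    rw [mem_closedBall_iff_norm]; exact h1.trans h2'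
  have haR' : a ∈ Metric.closedBall abar (R + M * R) :=
    Metric.closedBall_subset_closedBall (by linarith [mul_nonneg hM hR]) haR
  refine (linearization_error_le h1c hd (hMlip' u huR a haR')).trans
    (mul_le_mul_of_nonneg_right ?_ (sq_nonneg _))
  have h6 : r ≤ δ / (M' + 1) := hrr.trans (min_le_right _ _)
  rw [le_div_iff₀ (by linarith)] at h6
  rw [le_div_iff₀ hr]
  nlinarith

/-- The proximal gradient algorithm with backtracking is well defined. -/
theorem exists_isProxGradRun (h1c : ConvexOn ℝ Set.univ φ₁) (hd : Differentiable ℝ φ₁)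
    (hL : LocallyLipschitz (gradient φ₁)) (h2 : EProper φ₂) (h2l : LowerSemicontinuous φ₂)
    (h2c : EConvex φ₂) {abar : E n} (habar : φ₂ abar ≠ ⊤)
    (hmin : ∀ v, φ₂ v ≠ ⊤ → φ₁ abar + (φ₂ abar).toReal ≤ φ₁ v + (φ₂ v).toReal)
    (hδ : 0 < δ) (hθ : 0 < θ) (hθ1 : θ < 1) (hlam : 0 < lamBar) (α₀ : E n) :
    ∃ (α : ℕ → E n) (lam : ℕ → ℝ), α 0 = α₀ ∧ IsProxGradRun φ₁ φ₂ δ θ lamBar α lam := by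
  have hstep : ∀ a : E n, ∃ (r : ℝ) (u : E n),
      (∃ j : ℕ, IsLeast {j : ℕ | LinesearchTest φ₁ φ₂ δ a (lamBar * θ ^ j)} j ∧
        r = lamBar * θ ^ j) ∧ IsProx r φ₂ (a - r • gradient φ₁ a) u := by
    intro a
    obtain ⟨r₀, hr₀, h⟩ := exists_linesearchTest h1c hd hL h2 h2l h2c habar hmin hδ ‖a - abar‖
    obtain ⟨j, hj⟩ := exists_pow_lt_of_lt_one (div_pos hr₀ hlam) hθ1
    have hne : {j : ℕ | LinesearchTest φ₁ φ₂ δ a (lamBar * θ ^ j)}.Nonempty := by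
      refine ⟨j, h a le_rfl _ (by positivity) ?_⟩
      rw [lt_div_iff₀ hlam] at hj
      linarith
    obtain ⟨u, hu, -⟩ := Nat.sInf_mem hne
    exact ⟨_, u, ⟨_, ⟨Nat.sInf_mem hne, fun i hi => Nat.sInf_le hi⟩, rfl⟩, hu⟩
  choose r u hr hu using hstep
  obtain ⟨α, h0, hs⟩ : ∃ α : ℕ → E n, α 0 = α₀ ∧ ∀ m, α (m + 1) = u (α m) :=
    ⟨fun m => Nat.rec α₀ (fun _ a => u a) m, rfl, fun _ => rfl⟩
  exact ⟨α, fun m => r (α m), h0, ⟨fun m => hr (α m), fun m => by rw [hs]; exact hu (α m)⟩⟩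

section Run

variable {α : ℕ → E n} {lam : ℕ → ℝ}

theorem IsProxGradRun.lam_pos (hrun : IsProxGradRun φ₁ φ₂ δ θ lamBar α lam) (hθ : 0 < θ)
    (hlam : 0 < lamBar) (m : ℕ) : 0 < lam m := by
  obtain ⟨j, -, hj⟩ := hrun.stepsize m
  rw [hj]; positivity

theorem IsProxGradRun.lam_le (hrun : IsProxGradRun φ₁ φ₂ δ θ lamBar α lam) (hθ : 0 < θ)
    (hθ1 : θ < 1) (hlam : 0 < lamBar) (m : ℕ) : lam m ≤ lamBar := by
  obtain ⟨j, -, hj⟩ := hrun.stepsize m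
  rw [hj]
  exact mul_le_of_le_one_right hlam.le (pow_le_one₀ hθ.le hθ1.le)

theorem IsProxGradRun.ne_top (hrun : IsProxGradRun φ₁ φ₂ δ θ lamBar α lam) (h2 : EProper φ₂)
    (m : ℕ) : φ₂ (α (m + 1)) ≠ ⊤ :=
  (hrun.step m).ne_top h2

theorem IsProxGradRun.test (hrun : IsProxGradRun φ₁ φ₂ δ θ lamBar α lam) (h2 : EProper φ₂)
    (h2c : EConvex φ₂) (hθ : 0 < θ) (hlam : 0 < lamBar) (m : ℕ) :
    φ₁ (α (m + 1)) - φ₁ (α m) - inner ℝ (α (m + 1) - α m) (gradient φ₁ (α m)) ≤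
      δ / lam m * ‖α (m + 1) - α m‖ ^ 2 := by
  have hpos := hrun.lam_pos hθ hlam m
  obtain ⟨j, hj, hj'⟩ := hrun.stepsize m
  obtain ⟨u, hu, hut⟩ := hj.1
  rw [← hj'] at hu hut
  rwa [(hrun.step m).unique h2 h2c hpos hu]

/-- Descent properties of the algorithm with respect to a minimizer `abar` of `φ₁ + φ₂`. -/
theorem IsProxGradRun.descent (hrun : IsProxGradRun φ₁ φ₂ δ θ lamBar α lam)
    (h1c : ConvexOn ℝ Set.univ φ₁) (hd : Differentiable ℝ φ₁)
    (h2 : EProper φ₂) (h2c : EConvex φ₂) {abar : E n} (habar : φ₂ abar ≠ ⊤)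
    (hδ : 0 < δ) (hδ1 : δ < 1) (hθ : 0 < θ) (hθ1 : θ < 1) (hlam : 0 < lamBar)
    {e : ℕ → ℝ} (he : ∀ m, e m = (φ₁ (α (m + 1)) + (φ₂ (α (m + 1))).toReal) -
      (φ₁ abar + (φ₂ abar).toReal)) (m : ℕ) :
    e (m + 1) ≤ e m ∧
      ‖abar - α (m + 2)‖ ^ 2 + δ / (1 - δ) * lamBar * e (m + 1) + 2 * lam (m + 1) * e (m + 1) ≤
        ‖abar - α (m + 1)‖ ^ 2 + δ / (1 - δ) * lamBar * e m := by
  have hl := hrun.lam_pos hθ hlam (m + 1)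
  have hl' := hrun.lam_le hθ hθ1 hlam (m + 1)
  have ht := hrun.test h2 h2c hθ hlam (m + 1)
  -- Comparison with the current iterate yields decrease of the objective; comparison with `abar`
  -- yields the distance estimate. Starting at `α (m + 1)` matters, because `φ₂ (α 0)` may be
  -- infinite.
  have s1 := prox_grad_step_le h1c hd h2 h2c hl (hrun.step (m + 1)) ht (hrun.ne_top h2 m)
  have s2 := prox_grad_step_le h1c hd h2 h2c hl (hrun.step (m + 1)) ht habar
  rw [← he (m + 1)] at s2
  have e1 : φ₁ (α (m + 1 + 1)) + (φ₂ (α (m + 1 + 1))).toReal -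
      (φ₁ (α (m + 1)) + (φ₂ (α (m + 1))).toReal) = e (m + 1) - e m := by
    rw [he, he]; ring
  rw [e1, sub_self, norm_zero, norm_sub_rev (α (m + 1))] at s1
  change _ ∧ ‖abar - α (m + 1 + 1)‖ ^ 2 + _ + _ ≤ _
  set l := lam (m + 1)
  set N := ‖α (m + 1 + 1) - α (m + 1)‖ ^ 2
  have hN : 0 ≤ N := sq_nonneg _
  have h1δ : 0 < 1 - δ := by linarith
  have s3 : (1 - δ) * N ≤ l * (e m - e (m + 1)) := by linarith
  have hdec : e (m + 1) ≤ e m := by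
    have : 0 ≤ l * (e m - e (m + 1)) := le_trans (mul_nonneg h1δ.le hN) s3
    have := nonneg_of_mul_nonneg_right this hl
    linarith
  refine ⟨hdec, ?_⟩
  -- The term `(2δ - 1) N` may be positive; it is at most `δ N`, which the objective decrease pays
  -- for. This fixes the weight of `e` in the Lyapunov function.
  have s4 : δ * N ≤ δ / (1 - δ) * lamBar * (e m - e (m + 1)) := by
    have h3 : (1 - δ) * N ≤ lamBar * (e m - e (m + 1)) :=
      s3.trans (mul_le_mul_of_nonneg_right hl' (by linarith))
    rw [div_mul_eq_mul_div, div_mul_eq_mul_div, le_div_iff₀ h1δ]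
    nlinarith
  nlinarith

theorem IsProxGradRun.exists_le_lam (hrun : IsProxGradRun φ₁ φ₂ δ θ lamBar α lam)
    (h1c : ConvexOn ℝ Set.univ φ₁) (hd : Differentiable ℝ φ₁)
    (hL : LocallyLipschitz (gradient φ₁)) (h2 : EProper φ₂) (h2l : LowerSemicontinuous φ₂)
    (h2c : EConvex φ₂) {abar : E n} (habar : φ₂ abar ≠ ⊤)
    (hmin : ∀ v, φ₂ v ≠ ⊤ → φ₁ abar + (φ₂ abar).toReal ≤ φ₁ v + (φ₂ v).toReal)
    (hδ : 0 < δ) (hθ : 0 < θ) (hlam : 0 < lamBar)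
    {R : ℝ} (hR : ∀ m, ‖α m - abar‖ ≤ R) : ∃ b : ℝ, 0 < b ∧ ∀ m, b ≤ lam m := by
  obtain ⟨r₀, hr₀, h⟩ := exists_linesearchTest h1c hd hL h2 h2l h2c habar hmin hδ R
  refine ⟨min lamBar (θ * r₀), lt_min hlam (by positivity), fun m => ?_⟩
  obtain ⟨j, hj, hj'⟩ := hrun.stepsize m
  rw [hj']
  rcases j with _ | j
  · simp
  · refine (min_le_right _ _).trans ?_
    -- The previous trial stepsize failed the test, so it exceeds `r₀`; the accepted one is `θ`
    -- times it.
    have hlt : r₀ < lamBar * θ ^ j := by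
      by_contra hle
      have := hj.2 (h (α m) (hR m) (lamBar * θ ^ j) (by positivity) (not_lt.mp hle))
      omega
    have := mul_le_mul_of_nonneg_left hlt.le hθ.le
    rw [pow_succ]
    linarith

/-- Boundedness of the iterates, positive lower bound for the stepsizes, and the Lyapunov
inequality. -/
theorem IsProxGradRun.exists_lyapunov (hrun : IsProxGradRun φ₁ φ₂ δ θ lamBar α lam)
    (h1c : ConvexOn ℝ Set.univ φ₁) (hd : Differentiable ℝ φ₁)
    (hL : LocallyLipschitz (gradient φ₁)) (h2 : EProper φ₂) (h2l : LowerSemicontinuous φ₂)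
    (h2c : EConvex φ₂) {abar : E n} (habar : φ₂ abar ≠ ⊤)
    (hmin : ∀ v, φ₂ v ≠ ⊤ → φ₁ abar + (φ₂ abar).toReal ≤ φ₁ v + (φ₂ v).toReal)
    (hδ : 0 < δ) (hδ1 : δ < 1) (hθ : 0 < θ) (hθ1 : θ < 1) (hlam : 0 < lamBar)
    {e : ℕ → ℝ} (he : ∀ m, e m = (φ₁ (α (m + 1)) + (φ₂ (α (m + 1))).toReal) -
      (φ₁ abar + (φ₂ abar).toReal)) :
    (∀ m, 0 ≤ e m) ∧ Antitone e ∧ (∃ R, ∀ m, ‖α m - abar‖ ≤ R) ∧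
      ∃ b κ : ℝ, 0 < b ∧ 0 ≤ κ ∧ (∀ m, b ≤ lam m) ∧
        ∀ m, (‖abar - α (m + 2)‖ ^ 2 + κ * e (m + 1)) + b * e (m + 1) ≤
          ‖abar - α (m + 1)‖ ^ 2 + κ * e m := by
  have he0 : ∀ m, 0 ≤ e m := fun m => by
    rw [he]
    have := hmin _ (hrun.ne_top h2 m)
    linarith
  have hdesc := hrun.descent h1c hd h2 h2c habar hδ hδ1 hθ hθ1 hlam he
  set κ := δ / (1 - δ) * lamBar with hκ
  have hκ0 : 0 ≤ κ := mul_nonneg (div_nonneg hδ.le (by linarith)) hlam.le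
  have hanti : Antitone e := antitone_nat_of_succ_le fun m => (hdesc m).1
  -- This needs only positive stepsizes, so boundedness of the iterates is available before the
  -- uniform lower bound on `lam`.
  have hVanti : Antitone fun m => ‖abar - α (m + 1)‖ ^ 2 + κ * e m :=
    antitone_nat_of_succ_le fun m => by
      have h1 := (hdesc m).2
      have h3 := mul_nonneg (hrun.lam_pos hθ hlam (m + 1)).le (he0 (m + 1))
      show ‖abar - α (m + 2)‖ ^ 2 + _ ≤ _
      linarith
  obtain ⟨R, hR⟩ : ∃ R, ∀ m, ‖α m - abar‖ ≤ R := by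
    set V := ‖abar - α (0 + 1)‖ ^ 2 + κ * e 0
    refine ⟨max ‖α 0 - abar‖ √V, fun m => ?_⟩
    rcases m with _ | m
    · exact le_max_left _ _
    · refine le_max_of_le_right (Real.le_sqrt_of_sq_le ?_)
      have h1 := hVanti (Nat.zero_le m)
      have h3 := mul_nonneg hκ0 (he0 m)
      rw [norm_sub_rev]
      simp only at h1
      linarith
  obtain ⟨b, hb, hbl⟩ := hrun.exists_le_lam h1c hd hL h2 h2l h2c habar hmin hδ hθ hlam hR
  refine ⟨he0, hanti, ⟨R, hR⟩, b, κ, hb, hκ0, hbl, fun m => ?_⟩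
  have h1 := (hdesc m).2
  have h3 := mul_le_mul_of_nonneg_right (hbl (m + 1)) (he0 (m + 1))
  have h4 := mul_nonneg hb.le (he0 (m + 1))
  linarith

end Run

theorem summable_of_lyapunov {e V : ℕ → ℝ} {b : ℝ} (hb : 0 < b) (he : ∀ m, 0 ≤ e m)
    (hV0 : ∀ m, 0 ≤ V m) (hV : ∀ m, V (m + 1) + b * e (m + 1) ≤ V m) : Summable e := by
  rw [← summable_nat_add_iff 1]
  refine summable_of_sum_range_le (c := V 0 / b) (fun m => he _) fun m => ?_
  have key : ∀ m, b * ∑ i ∈ Finset.range m, e (i + 1) + V m ≤ V 0 := by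
    intro m
    induction m with
    | zero => simp
    | succ k ih =>
      rw [Finset.sum_range_succ, mul_add]
      linarith [hV k]
  rw [le_div_iff₀ hb]
  linarith [key m, hV0 m]

end Algorithm

/-! ### Fenchel conjugates on the line. -/

section Conjugate

variable {f : ℝ → ℝ}

theorem le_conjugate (f : ℝ → ℝ) (s t : ℝ) : ((s * t - f t : ℝ) : EReal) ≤ conjugate f s :=
  le_iSup (fun t : ℝ => ((s * t - f t : ℝ) : EReal)) t

theorem conjugate_ne_bot (f : ℝ → ℝ) (s : ℝ) : conjugate f s ≠ ⊥ :=
  ne_bot_of_le_ne_bot (EReal.coe_ne_bot _) (le_conjugate f s 0)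

theorem le_conjugate_toReal {s : ℝ} (hs : conjugate f s ≠ ⊤) (t : ℝ) :
    s * t - f t ≤ (conjugate f s).toReal := by
  have := le_conjugate f s t
  rwa [← EReal.coe_toReal hs (conjugate_ne_bot f s), EReal.coe_le_coe_iff] at this

theorem conjugate_eq_of_subgradient {s t : ℝ} (h : ∀ t', f t + s * (t' - t) ≤ f t') :
    conjugate f s = ((s * t - f t : ℝ) : EReal) := by
  refine le_antisymm (iSup_le fun t' => ?_) (le_conjugate f s t)
  rw [EReal.coe_le_coe_iff]
  linarith [h t']

theorem exists_subgradient (hf : ConvexOn ℝ Set.univ f) (t : ℝ) :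
    ∃ s, ∀ t', f t + s * (t' - t) ≤ f t' := by
  have ht : t ∈ interior (Set.univ : Set ℝ) := by simp
  refine ⟨derivWithin f (Set.Ioi t) t, fun t' => ?_⟩
  rcases lt_trichotomy t t' with h | rfl | h
  · have := hf.rightDeriv_le_slope_of_mem_interior ht (Set.mem_univ t') h
    rw [slope_def_field, le_div_iff₀ (by linarith)] at this
    linarith
  · simp
  · have := (hf.slope_le_leftDeriv_of_mem_interior (Set.mem_univ t') ht h).trans
      (hf.leftDeriv_le_rightDeriv_of_mem_interior ht)
    rw [slope_def_field, div_le_iff₀ (by linarith)] at this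
    linarith

theorem abs_sub_le_conjugate (f : ℝ → ℝ) (s : ℝ) :
    ((|s| - max (f 1) (f (-1)) : ℝ) : EReal) ≤ conjugate f s := by
  rcases abs_cases s with h | h
  · refine le_trans ?_ (le_conjugate f s 1)
    rw [EReal.coe_le_coe_iff]
    linarith [le_max_left (f 1) (f (-1))]
  · refine le_trans ?_ (le_conjugate f s (-1))
    rw [EReal.coe_le_coe_iff]
    linarith [le_max_right (f 1) (f (-1))]

/-- Strong convexity inequality of modulus `μ` for the conjugate of `f`, from the splitting
property `h` of the affine functions whose supremum it is. -/
theorem conjugate_combo_le {μ : ℝ} (h : ∀ s s' τ t : ℝ, 0 < τ → τ < 1 → ∃ t₁ t₂ : ℝ,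
      (τ * s + (1 - τ) * s') * t - f t + μ / 2 * τ * (1 - τ) * (s - s') ^ 2 ≤
        τ * (s * t₁ - f t₁) + (1 - τ) * (s' * t₂ - f t₂))
    {s s' τ : ℝ} (hs : conjugate f s ≠ ⊤) (hs' : conjugate f s' ≠ ⊤) (hτ : 0 < τ) (hτ1 : τ < 1) :
    conjugate f (τ * s + (1 - τ) * s') ≤ ((τ * (conjugate f s).toReal +
      (1 - τ) * (conjugate f s').toReal - μ / 2 * τ * (1 - τ) * (s - s') ^ 2 : ℝ) : EReal) := by
  refine iSup_le fun t => ?_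
  obtain ⟨t₁, t₂, ht⟩ := h s s' τ t hτ hτ1
  rw [EReal.coe_le_coe_iff]
  have h1 := mul_le_mul_of_nonneg_left (le_conjugate_toReal hs t₁) hτ.le
  have h2 := mul_le_mul_of_nonneg_left (le_conjugate_toReal hs' t₂) (by linarith : 0 ≤ 1 - τ)
  linarith

theorem conjugate_split_zero (f : ℝ → ℝ) (s s' τ t : ℝ) (_ : 0 < τ) (_ : τ < 1) : ∃ t₁ t₂ : ℝ,
    (τ * s + (1 - τ) * s') * t - f t + 0 / 2 * τ * (1 - τ) * (s - s') ^ 2 ≤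
      τ * (s * t₁ - f t₁) + (1 - τ) * (s' * t₂ - f t₂) :=
  ⟨t, t, by apply le_of_eq; ring⟩

/-- Smoothness of `f` dualizes to strong convexity of its conjugate. The points `t₁, t₂` have
barycentre `t` and differ by `s - s'`: the linear terms gain `τ(1-τ)(s-s')²`, and `f` loses at most
half of it. -/
theorem conjugate_split_one (hf : ConvexOn ℝ Set.univ fun t => 1 / 2 * t ^ 2 - f t)
    (s s' τ t : ℝ) (hτ : 0 < τ) (hτ1 : τ < 1) : ∃ t₁ t₂ : ℝ,
    (τ * s + (1 - τ) * s') * t - f t + 1 / 2 * τ * (1 - τ) * (s - s') ^ 2 ≤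
      τ * (s * t₁ - f t₁) + (1 - τ) * (s' * t₂ - f t₂) := by
  refine ⟨t + (1 - τ) * (s - s'), t - τ * (s - s'), ?_⟩
  have h := hf.2 (Set.mem_univ (t + (1 - τ) * (s - s'))) (Set.mem_univ (t - τ * (s - s'))) hτ.le
    (by linarith : 0 ≤ 1 - τ) (by ring)
  have e : τ • (t + (1 - τ) * (s - s')) + (1 - τ) • (t - τ * (s - s')) = t := by
    simp only [smul_eq_mul]; ring
  rw [e] at h
  simp only [smul_eq_mul] at h
  nlinarith

end Conjugate

/-! ### Extended-real sums and strong convexity. -/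

section EReal

theorem sum_ne_bot {ι : Type*} (s : Finset ι) {f : ι → EReal} (h : ∀ i, f i ≠ ⊥) :
    ∑ i ∈ s, f i ≠ ⊥ :=
  Finset.sum_induction f (fun x => x ≠ ⊥) (fun _ _ ha hb => EReal.add_ne_bot_iff.mpr ⟨ha, hb⟩)
    EReal.zero_ne_bot fun i _ => h i

theorem sum_eq_top {ι : Type*} [DecidableEq ι] {s : Finset ι} {f : ι → EReal} (h : ∀ i, f i ≠ ⊥)
    {i : ι} (hi : i ∈ s) (ht : f i = ⊤) : ∑ i ∈ s, f i = ⊤ := by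
  rw [← Finset.add_sum_erase s f hi, ht, EReal.top_add_of_ne_bot (sum_ne_bot _ h)]

theorem coe_sum {ι : Type*} (s : Finset ι) (f : ι → ℝ) :
    ((∑ i ∈ s, f i : ℝ) : EReal) = ∑ i ∈ s, (f i : EReal) :=
  map_sum (⟨⟨((↑) : ℝ → EReal), EReal.coe_zero⟩, EReal.coe_add⟩ : ℝ →+ EReal) f s

theorem eStronglyConvexWith_of_real {V : Type*} [NormedAddCommGroup V] [NormedSpace ℝ V] {μ : ℝ}
    {f : V → EReal} (hbot : ∀ v, f v ≠ ⊥)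
    (h : ∀ u v : V, f u ≠ ⊤ → f v ≠ ⊤ → ∀ t : ℝ, 0 < t → t < 1 → f (t • u + (1 - t) • v) ≤
      ((t * (f u).toReal + (1 - t) * (f v).toReal - μ / 2 * t * (1 - t) * ‖u - v‖ ^ 2 : ℝ) :
        EReal)) :
    EStronglyConvexWith μ f := by
  have mul_ne : ∀ (c : ℝ) (v : V), 0 < c → (c : EReal) * f v ≠ ⊥ := by
    intro c v hc
    by_cases hv : f v = ⊤
    · rw [hv, EReal.coe_mul_top_of_pos hc]; exact top_ne_bot
    · rw [← EReal.coe_toReal hv (hbot v), ← EReal.coe_mul]; exact EReal.coe_ne_bot _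
  intro u v t ht ht1
  have ht1' : 0 < 1 - t := by linarith
  by_cases hu : f u = ⊤
  · rw [hu, EReal.coe_mul_top_of_pos ht, EReal.top_add_of_ne_bot (mul_ne _ v ht1')]
    exact le_top
  by_cases hv : f v = ⊤
  · rw [hv, EReal.coe_mul_top_of_pos ht1', EReal.add_top_of_ne_bot (mul_ne _ u ht)]
    exact le_top
  have h1 := h u v hu hv t ht ht1
  have hw := ne_top_of_le_ne_top (EReal.coe_ne_top _) h1
  rw [← EReal.coe_toReal hw (hbot _), EReal.coe_le_coe_iff] at h1
  rw [← EReal.coe_toReal hw (hbot _)]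
  conv_rhs => rw [← EReal.coe_toReal hu (hbot u), ← EReal.coe_toReal hv (hbot v)]
  rw [← EReal.coe_mul, ← EReal.coe_mul, ← EReal.coe_add, ← EReal.coe_add, EReal.coe_le_coe_iff]
  linarith

theorem EStronglyConvexWith.eConvex {V : Type*} [NormedAddCommGroup V] [NormedSpace ℝ V]
    {f : V → EReal} (h : EStronglyConvexWith 0 f) : EConvex f := by
  intro u v t ht ht1
  simpa using h u v t ht ht1

theorem convexOn_conjugate_toReal (f : ℝ → ℝ) :
    ConvexOn ℝ {s | conjugate f s ≠ ⊤} fun s => (conjugate f s).toReal := by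
  refine (EStronglyConvexWith.eConvex (eStronglyConvexWith_of_real (conjugate_ne_bot f)
    fun u v hu hv t ht ht1 => ?_)).convexOn_toReal (conjugate_ne_bot f)
  simpa using conjugate_combo_le (conjugate_split_zero f) hu hv ht ht1

end EReal

/-! ### Feature operator and derivative of the norm power. -/

section Feature

variable {X K : Type*} {p q : ℝ} {n : ℕ}

theorem fact_one_le_ofReal (hq : 1 ≤ q) : Fact (1 ≤ ENNReal.ofReal q) :=
  ⟨by rw [← ENNReal.ofReal_one]; exact ENNReal.ofReal_le_ofReal hq⟩

theorem featureAdj_add_smul (Φ : X → Ell q K) (x : Fin n → X) (a b : E n) (c d : ℝ) :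
    featureAdj Φ x (c • a + d • b) = c • featureAdj Φ x a + d • featureAdj Φ x b := by
  simp only [featureAdj, Finset.smul_sum, ← Finset.sum_add_distrib, smul_smul, ← add_smul]
  rfl

theorem pairing_featureAdj (hpq : p.HolderConjugate q) (Φ : X → Ell q K) (x : Fin n → X) (a : E n)
    (w : Ell p K) : pairing (featureAdj Φ x a) w = ∑ i, a i * pairing (Φ (x i)) w := by
  let P : Ell q K →+ ℝ := AddMonoidHom.mk' (fun u => pairing u w) fun u v => by
    have h := pairing_sub_left hpq (u + v) v w
    rw [add_sub_cancel_right] at h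
    linarith
  have h : P (featureAdj Φ x a) = ∑ i, P (a i • Φ (x i)) := map_sum P _ _
  simpa only [P, AddMonoidHom.mk'_apply, pairing_smul_left hpq] using h

theorem norm_featureAdj_le (hq : 1 ≤ q) (Φ : X → Ell q K) (x : Fin n → X) {R : ℝ} {a : E n}
    (ha : ‖a‖ ≤ R) : ‖featureAdj Φ x a‖ ≤ ∑ i, R * ‖Φ (x i)‖ := by
  have := fact_one_le_ofReal hq
  refine (norm_sum_le _ _).trans (Finset.sum_le_sum fun i _ => ?_)
  rw [norm_smul]
  exact mul_le_mul_of_nonneg_right ((PiLp.norm_apply_le a i).trans ha) (norm_nonneg _)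

theorem one_div_mul_norm_rpow_combo_le (hq : 1 < q) (u v : Ell q K) {t : ℝ} (ht : 0 < t)
    (ht1 : t < 1) : 1 / q * ‖t • u + (1 - t) • v‖ ^ q ≤
      t * (1 / q * ‖u‖ ^ q) + (1 - t) * (1 / q * ‖v‖ ^ q) := by
  have := fact_one_le_ofReal hq.le
  have h1 : ‖t • u + (1 - t) • v‖ ≤ t * ‖u‖ + (1 - t) * ‖v‖ := by
    refine (norm_add_le _ _).trans (le_of_eq ?_)
    rw [norm_smul, norm_smul, Real.norm_of_nonneg ht.le, Real.norm_of_nonneg (by linarith)]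
  have h2 := Real.rpow_le_rpow (norm_nonneg _) h1 (by linarith : 0 ≤ q)
  have h3 := (convexOn_rpow hq.le).2 (norm_nonneg u : ‖u‖ ∈ Set.Ici 0)
    (norm_nonneg v : ‖v‖ ∈ Set.Ici 0) ht.le (by linarith : 0 ≤ 1 - t) (by ring)
  simp only [smul_eq_mul] at h3
  have h4 := mul_le_mul_of_nonneg_left (h2.trans h3) (by positivity : 0 ≤ 1 / q)
  linarith

theorem sub_eq_youngGap (hpq : p.HolderConjugate q) (u v : Ell q K) :
    1 / q * ‖v‖ ^ q - 1 / q * ‖u‖ ^ q - pairing (v - u) (dualityMap hpq u) =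
      youngGap v (dualityMap hpq u) := by
  have h1 := youngGap_dualityMap hpq u
  rw [pairing_sub_left hpq]
  simp only [youngGap] at *
  linarith

/-- The duality map is the derivative of `(1/q) ‖·‖_q^q` along lines. -/
theorem hasDerivAt_norm_rpow_line (hpq : p.HolderConjugate q) (hp2 : p ≤ 2) (u v : Ell q K) :
    HasDerivAt (fun t : ℝ => 1 / q * ‖u + t • v‖ ^ q) (pairing v (dualityMap hpq u)) 0 := by
  have := fact_one_le_ofReal hpq.symm.lt.le
  obtain ⟨C, hC, h⟩ := exists_youngGap_dualityMap_le (K := K) hpq hp2 (‖u‖ + ‖v‖)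
  rw [hasDerivAt_iff_isLittleO_nhds_zero]
  -- The first-order remainder is a Young gap, hence quadratic in `t` on bounded sets.
  refine IsBigO.trans_isLittleO (g := fun t : ℝ => t ^ 2) ?_ ?_
  · refine IsBigO.of_bound (C * ‖v‖ ^ 2) ?_
    filter_upwards [Metric.ball_mem_nhds (0 : ℝ) one_pos] with t ht
    rw [mem_ball_zero_iff, Real.norm_eq_abs] at ht
    have h1 := sub_eq_youngGap hpq u (u + t • v)
    rw [add_sub_cancel_left, pairing_smul_left hpq] at h1
    have h2 : ‖u + t • v‖ ≤ ‖u‖ + ‖v‖ := by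
      refine (norm_add_le _ _).trans (add_le_add le_rfl ?_)
      rw [norm_smul, Real.norm_eq_abs]
      exact mul_le_of_le_one_left (norm_nonneg _) ht.le
    have h3 := h u (u + t • v) (le_add_of_nonneg_right (norm_nonneg _)) h2
    rw [add_sub_cancel_left, norm_smul, mul_pow] at h3
    rw [zero_add, zero_smul, add_zero, smul_eq_mul, h1,
      Real.norm_of_nonneg (youngGap_nonneg hpq hp2 _ _), norm_pow]
    linarith
  · exact isLittleO_pow_id one_lt_two

end Feature

/-! ### Coercivity and strong convexity of the dual objective. -/

section Dual

variable {X Y K : Type*} {p q : ℝ} {n : ℕ} {γ : ℝ} {Φ : X → Ell q K} {L : Y → ℝ → ℝ}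
  {x : Fin n → X} {y : Fin n → Y}

theorem dualObj_eq_coe {a : E n} (ha : ∀ i, conjugate (L (y i)) (-(a i) / γ) ≠ ⊤) :
    dualObj γ Φ L x y a = ((1 / q * ‖featureAdj Φ x a‖ ^ q +
      γ * ∑ i, (conjugate (L (y i)) (-(a i) / γ)).toReal : ℝ) : EReal) := by
  rw [EReal.coe_add, EReal.coe_mul γ, coe_sum, dualObj]
  simp only [EReal.coe_toReal (ha _) (conjugate_ne_bot _ _)]

theorem dualObj_eq_top (hγ : 0 < γ) {a : E n} {i : Fin n}
    (ha : conjugate (L (y i)) (-(a i) / γ) = ⊤) : dualObj γ Φ L x y a = ⊤ := by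
  rw [dualObj, sum_eq_top (f := fun i => conjugate (L (y i)) (-(a i) / γ))
    (fun i => conjugate_ne_bot _ _) (Finset.mem_univ i) ha,
    EReal.coe_mul_top_of_pos hγ, EReal.coe_add_top]

theorem dualObj_ne_top_iff (hγ : 0 < γ) {a : E n} :
    dualObj γ Φ L x y a ≠ ⊤ ↔ ∀ i, conjugate (L (y i)) (-(a i) / γ) ≠ ⊤ := by
  refine ⟨fun h i hi => h (dualObj_eq_top hγ hi), fun h => ?_⟩
  rw [dualObj_eq_coe h]
  exact EReal.coe_ne_top _

theorem norm_le_sum_abs (a : E n) : ‖a‖ ≤ ∑ i, |a i| := by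
  refine (sq_le_sq₀ (norm_nonneg a) (Finset.sum_nonneg fun i _ => abs_nonneg (a i))).mp ?_
  rw [EuclideanSpace.real_norm_sq_eq]
  simpa using Finset.sum_sq_le_sq_sum_of_nonneg (s := Finset.univ) (f := fun i => |a i|)
    fun i _ => abs_nonneg _

/-- Coercivity: since the losses are finite at `±1`, each conjugate grows at least like `|s|`. -/
theorem norm_sub_le_dualObj (hγ : 0 < γ) (hq : 0 < q) (a : E n) :
    ((‖a‖ - γ * ∑ i, max (L (y i) 1) (L (y i) (-1)) : ℝ) : EReal) ≤ dualObj γ Φ L x y a := by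
  by_cases ha : dualObj γ Φ L x y a = ⊤
  · rw [ha]; exact le_top
  have ha' := (dualObj_ne_top_iff hγ).mp ha
  rw [dualObj_eq_coe ha', EReal.coe_le_coe_iff]
  have h1 : ∀ i, |a i| / γ - max (L (y i) 1) (L (y i) (-1)) ≤
      (conjugate (L (y i)) (-(a i) / γ)).toReal := fun i => by
    have := abs_sub_le_conjugate (L (y i)) (-(a i) / γ)
    rw [← EReal.coe_toReal (ha' i) (conjugate_ne_bot _ _), EReal.coe_le_coe_iff, abs_div, abs_neg,
      abs_of_pos hγ] at this
    exact this
  have h2 := mul_le_mul_of_nonneg_left (Finset.sum_le_sum fun i (_ : i ∈ Finset.univ) => h1 i) hγ.le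
  rw [Finset.sum_sub_distrib, ← Finset.sum_div, mul_sub, mul_div_cancel₀ _ hγ.ne'] at h2
  have h3 : 0 ≤ 1 / q * ‖featureAdj Φ x a‖ ^ q :=
    mul_nonneg (by positivity) (Real.rpow_nonneg (lp.norm_nonneg' _) _)
  linarith [norm_le_sum_abs a]

theorem dualObj_ne_bot (hγ : 0 < γ) (hq : 0 < q) (a : E n) : dualObj γ Φ L x y a ≠ ⊥ :=
  ne_bot_of_le_ne_bot (EReal.coe_ne_bot _) (norm_sub_le_dualObj hγ hq a)

/-- Strong convexity of the conjugate losses gives strong convexity of the dual objective. -/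
theorem dualObj_eStronglyConvex (hγ : 0 < γ) (hq : 1 < q)
    (hL : ∀ b, ConvexOn ℝ Set.univ fun t => 1 / 2 * t ^ 2 - L b t) :
    EStronglyConvex (dualObj γ Φ L x y) := by
  -- Each conjugate has modulus 1; rescaling the argument by `1/γ` and multiplying by `γ` leaves
  -- `1/γ`.
  refine ⟨1 / γ, by positivity, eStronglyConvexWith_of_real
    (dualObj_ne_bot hγ (by linarith)) fun u v hu hv t ht ht1 => ?_⟩
  have hu' := (dualObj_ne_top_iff hγ).mp hu
  have hv' := (dualObj_ne_top_iff hγ).mp hv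
  have key : ∀ i, conjugate (L (y i)) (-((t • u + (1 - t) • v) i) / γ) ≤
      ((t * (conjugate (L (y i)) (-(u i) / γ)).toReal +
        (1 - t) * (conjugate (L (y i)) (-(v i) / γ)).toReal -
        1 / 2 * t * (1 - t) * ((u i - v i) ^ 2 / γ ^ 2) : ℝ) : EReal) := by
    intro i
    have h := conjugate_combo_le (conjugate_split_one (hL (y i))) (hu' i) (hv' i) ht ht1
    have e1 : -((t • u + (1 - t) • v) i) / γ = t * (-(u i) / γ) + (1 - t) * (-(v i) / γ) := by
      simp only [PiLp.add_apply, PiLp.smul_apply, smul_eq_mul]; ring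
    have e2 : (-(u i) / γ - -(v i) / γ) ^ 2 = (u i - v i) ^ 2 / γ ^ 2 := by
      rw [← sub_div, div_pow]; ring
    rw [e1, ← e2]
    exact h
  have hw : ∀ i, conjugate (L (y i)) (-((t • u + (1 - t) • v) i) / γ) ≠ ⊤ :=
    fun i => ne_top_of_le_ne_top (EReal.coe_ne_top _) (key i)
  rw [dualObj_eq_coe hw, dualObj_eq_coe hu', dualObj_eq_coe hv', EReal.coe_le_coe_iff,
    EReal.toReal_coe, EReal.toReal_coe, featureAdj_add_smul]
  have h1 := one_div_mul_norm_rpow_combo_le hq (featureAdj Φ x u) (featureAdj Φ x v) ht ht1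
  have h2 : ∑ i, (conjugate (L (y i)) (-((t • u + (1 - t) • v) i) / γ)).toReal ≤
      ∑ i, (t * (conjugate (L (y i)) (-(u i) / γ)).toReal +
        (1 - t) * (conjugate (L (y i)) (-(v i) / γ)).toReal -
        1 / 2 * t * (1 - t) * ((u i - v i) ^ 2 / γ ^ 2)) :=
    Finset.sum_le_sum fun i _ => by
      have := key i
      rwa [← EReal.coe_toReal (hw i) (conjugate_ne_bot _ _), EReal.coe_le_coe_iff] at this
  rw [Finset.sum_sub_distrib, Finset.sum_add_distrib, ← Finset.mul_sum, ← Finset.mul_sum,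
    ← Finset.mul_sum, ← Finset.sum_div] at h2
  have h3 : ∑ i, (u i - v i) ^ 2 = ‖u - v‖ ^ 2 := by
    rw [EuclideanSpace.real_norm_sq_eq]; rfl
  rw [h3] at h2
  have h4 := mul_le_mul_of_nonneg_left h2 hγ.le
  have h5 : 1 / γ / 2 * t * (1 - t) * ‖u - v‖ ^ 2 =
      γ * (1 / 2 * t * (1 - t) * (‖u - v‖ ^ 2 / γ ^ 2)) := by field_simp
  rw [h5]
  linarith

end Dual

/-! ### Smoothness of the two losses. -/

section Losses

theorem convexOn_sq_sub_leastSquaresLoss (b : ℝ) :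
    ConvexOn ℝ Set.univ fun t => 1 / 2 * t ^ 2 - leastSquaresLoss b t := by
  refine ⟨convex_univ, fun s _ t _ c d _ _ hcd => le_of_eq ?_⟩
  simp only [leastSquaresLoss, sq_abs, smul_eq_mul]
  obtain rfl : d = 1 - c := by linarith
  ring

theorem convexOn_sq_sub_logisticLoss (b : ({-1, 1} : Set ℝ)) :
    ConvexOn ℝ Set.univ fun t => 1 / 2 * t ^ 2 - logisticLoss b t := by
  obtain ⟨b, hb⟩ := b
  have hb2 : b ^ 2 = 1 := by
    rcases hb with rfl | rfl <;> norm_num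
  simp only [logisticLoss]
  have he : ∀ t : ℝ, HasDerivAt (fun t => 1 + Real.exp (-(b * t)))
      (Real.exp (-(b * t)) * (-b)) t := fun t => by
    have := (((hasDerivAt_id t).const_mul b).neg.exp).const_add 1
    simpa using this
  have hpos : ∀ t : ℝ, 0 < 1 + Real.exp (-(b * t)) := fun t => by positivity
  have h1 : ∀ t : ℝ, HasDerivAt (fun t => 1 / 2 * t ^ 2 - Real.log (1 + Real.exp (-(b * t))))
      (t + b - b / (1 + Real.exp (-(b * t)))) t := fun t => by
    have h := ((hasDerivAt_pow 2 t).const_mul (1 / 2)).sub ((he t).log (hpos t).ne')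
    refine h.congr_deriv ?_
    have := (hpos t).ne'
    field_simp
    push_cast
    ring
  have h2 : ∀ t : ℝ, HasDerivAt (fun t => t + b - b / (1 + Real.exp (-(b * t))))
      (1 - Real.exp (-(b * t)) / (1 + Real.exp (-(b * t))) ^ 2) t := fun t => by
    have h := ((hasDerivAt_id t).add_const b).sub ((hasDerivAt_const t b).div (he t) (hpos t).ne')
    refine h.congr_deriv ?_
    have e : b * (Real.exp (-(b * t)) * -b) = -Real.exp (-(b * t)) := by
      linear_combination (-Real.exp (-(b * t))) * hb2
    rw [e]
    ring
  refine convexOn_of_hasDerivWithinAt2_nonneg convex_univ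
    (fun t _ => (h1 t).continuousAt.continuousWithinAt) (fun t _ => (h1 t).hasDerivWithinAt)
    (fun t _ => (h2 t).hasDerivWithinAt) fun t _ => ?_
  -- With `E = exp(-bt)`, the second derivative is `1 - E / (1 + E)²`, and `E ≤ (1 + E)²`.
  rw [sub_nonneg, div_le_one (pow_pos (hpos t) 2)]
  nlinarith [Real.exp_pos (-(b * t))]

end Losses

/-! ### Primal-dual gap estimates. -/

section Duality

variable {X Y K : Type*} {p q : ℝ} {n : ℕ} {γ : ℝ} {Φ : X → Ell q K} {L : Y → ℝ → ℝ}
  {x : Fin n → X} {y : Fin n → Y}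

/-- At a dual minimizer the Fenchel equality holds for the losses. -/
theorem sum_conjugate_le_of_isMinOn (hpq : p.HolderConjugate q) (hp2 : p ≤ 2) (hγ : 0 < γ)
    (hL : ∀ b, ConvexOn ℝ Set.univ (L b)) {abar : E n} (habar : dualObj γ Φ L x y abar ≠ ⊤)
    (hmin : IsMinOn (dualObj γ Φ L x y) Set.univ abar) :
    ∑ i, (conjugate (L (y i)) (-(abar i) / γ)).toReal ≤
      ∑ i, (-(abar i) / γ * pairing (Φ (x i)) (dualityMap hpq (featureAdj Φ x abar)) -
        L (y i) (pairing (Φ (x i)) (dualityMap hpq (featureAdj Φ x abar)))) := by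
  set wbar := dualityMap hpq (featureAdj Φ x abar) with hwbar
  set ψ : E n → ℝ := fun a => γ * ∑ i, (conjugate (L (y i)) (-(a i) / γ)).toReal with hψ
  set D : Set (E n) := {a | ∀ i, conjugate (L (y i)) (-(a i) / γ) ≠ ⊤} with hD
  have hDbar : abar ∈ D := (dualObj_ne_top_iff hγ).mp habar
  have hcoord : ∀ (a b : E n) (c d : ℝ) (i : Fin n),
      -((c • a + d • b) i) / γ = c * (-(a i) / γ) + d * (-(b i) / γ) := fun a b c d i => by
    simp only [PiLp.add_apply, PiLp.smul_apply, smul_eq_mul]; ring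
  have hψc : ConvexOn ℝ D ψ := by
    refine ⟨fun a ha b hb c d hc hd hcd i => ?_, fun a ha b hb c d hc hd hcd => ?_⟩
    · rw [hcoord]
      exact (convexOn_conjugate_toReal (L (y i))).1 (ha i) (hb i) hc hd hcd
    · have h : ∀ i, (conjugate (L (y i)) (-((c • a + d • b) i) / γ)).toReal ≤
          c * (conjugate (L (y i)) (-(a i) / γ)).toReal +
            d * (conjugate (L (y i)) (-(b i) / γ)).toReal := fun i => by
        rw [hcoord]
        exact (convexOn_conjugate_toReal (L (y i))).2 (ha i) (hb i) hc hd hcd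
      have h1 := mul_le_mul_of_nonneg_left
        (Finset.sum_le_sum fun i (_ : i ∈ Finset.univ) => h i) hγ.le
      rw [Finset.sum_add_distrib, ← Finset.mul_sum, ← Finset.mul_sum] at h1
      simp only [hψ, smul_eq_mul]
      linarith
  -- The comparison point `a` has `-aᵢ/γ` equal to a subgradient of the loss at `⟨Φ(xᵢ), wbar⟩`, so
  -- its conjugates are explicit. Optimality of `abar` in the direction `a - abar` then cancels the
  -- subgradients and leaves Fenchel equality.
  choose s hs using fun i => exists_subgradient (hL (y i)) (pairing (Φ (x i)) wbar)
  set a : E n := WithLp.toLp 2 fun i => -(γ * s i) with ha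
  have hsa : ∀ i, -(a i) / γ = s i := fun i => by
    simp only [ha, neg_neg]; exact mul_div_cancel_left₀ _ hγ.ne'
  have hconj : ∀ i, conjugate (L (y i)) (-(a i) / γ) =
      ((s i * pairing (Φ (x i)) wbar - L (y i) (pairing (Φ (x i)) wbar) : ℝ) : EReal) := fun i => by
    rw [hsa]; exact conjugate_eq_of_subgradient (hs i)
  have hDa : a ∈ D := fun i => by rw [hconj]; exact EReal.coe_ne_top _
  have hlin : ∀ t : ℝ, featureAdj Φ x (abar + t • (a - abar)) =
      featureAdj Φ x abar + t • featureAdj Φ x (a - abar) := fun t => by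
    simpa using featureAdj_add_smul Φ x abar (a - abar) 1 t
  have hder : HasDerivAt (fun t : ℝ => 1 / q * ‖featureAdj Φ x (abar + t • (a - abar))‖ ^ q)
      (pairing (featureAdj Φ x (a - abar)) wbar) 0 := by
    simp only [hlin]
    exact hasDerivAt_norm_rpow_line hpq hp2 _ _
  have hopt := le_add_of_isMinOn_add hψc hDbar hDa
    (g := fun a => 1 / q * ‖featureAdj Φ x a‖ ^ q) hder fun v hv => by
      have h : dualObj γ Φ L x y abar ≤ dualObj γ Φ L x y v := hmin (Set.mem_univ v)
      rw [dualObj_eq_coe hDbar, dualObj_eq_coe hv, EReal.coe_le_coe_iff] at h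
      simp only [hψ]
      linarith
  rw [pairing_featureAdj hpq] at hopt
  simp only [hψ, hconj, EReal.toReal_coe] at hopt
  have h1 : ∑ i, (a - abar) i * pairing (Φ (x i)) wbar =
      γ * ∑ i, (-(abar i) / γ - s i) * pairing (Φ (x i)) wbar := by
    rw [Finset.mul_sum]
    refine Finset.sum_congr rfl fun i _ => ?_
    have : (a - abar) i = -(γ * s i) - abar i := rfl
    rw [this]
    field_simp
    ring
  rw [h1, ← mul_add, ← Finset.sum_add_distrib] at hopt
  refine (le_of_mul_le_mul_left hopt hγ).trans (le_of_eq ?_)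
  exact Finset.sum_congr rfl fun i _ => by ring

/-- Fenchel–Young for the losses at `w` against Fenchel equality at `wbar`; the linear terms
assemble into the pairing with `Φₙ* abar`. -/
theorem youngGap_le_primalObj_sub (hpq : p.HolderConjugate q) (hp2 : p ≤ 2) (hγ : 0 < γ)
    (hL : ∀ b, ConvexOn ℝ Set.univ (L b)) {abar : E n} (habar : dualObj γ Φ L x y abar ≠ ⊤)
    (hmin : IsMinOn (dualObj γ Φ L x y) Set.univ abar) (w : Ell p K) :
    youngGap (featureAdj Φ x abar) w ≤ primalObj γ Φ L x y w -
      primalObj γ Φ L x y (dualityMap hpq (featureAdj Φ x abar)) := by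
  have h1 := sum_conjugate_le_of_isMinOn hpq hp2 hγ hL habar hmin
  have hD := (dualObj_ne_top_iff hγ).mp habar
  set ubar := featureAdj Φ x abar with hubar
  set wbar := dualityMap hpq ubar with hwbar
  have h2 := Finset.sum_le_sum fun i (_ : i ∈ Finset.univ) =>
    le_conjugate_toReal (hD i) (pairing (Φ (x i)) w)
  have h3 := h2.trans h1
  rw [Finset.sum_sub_distrib, Finset.sum_sub_distrib] at h3
  have h4 : ∀ z : Ell p K, γ * ∑ i, -(abar i) / γ * pairing (Φ (x i)) z = - pairing ubar z := by
    intro z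
    rw [hubar, pairing_featureAdj hpq, Finset.mul_sum, ← Finset.sum_neg_distrib]
    refine Finset.sum_congr rfl fun i _ => ?_
    field_simp
  have h5 := mul_le_mul_of_nonneg_left h3 hγ.le
  rw [mul_sub, mul_sub, h4, h4] at h5
  have h6 := youngGap_dualityMap hpq ubar
  simp only [youngGap, primalObj] at *
  linarith

/-- Here `wbar` is fixed and Fenchel–Young is applied at `a`. This turns decay of dual values into
convergence of primal iterates. -/
theorem youngGap_le_dualObj_sub (hpq : p.HolderConjugate q) (hp2 : p ≤ 2) (hγ : 0 < γ)
    (hL : ∀ b, ConvexOn ℝ Set.univ (L b)) {abar : E n} (habar : dualObj γ Φ L x y abar ≠ ⊤)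
    (hmin : IsMinOn (dualObj γ Φ L x y) Set.univ abar) {a : E n}
    (ha : dualObj γ Φ L x y a ≠ ⊤) :
    youngGap (featureAdj Φ x a) (dualityMap hpq (featureAdj Φ x abar)) ≤
      (dualObj γ Φ L x y a).toReal - (dualObj γ Φ L x y abar).toReal := by
  have h1 := sum_conjugate_le_of_isMinOn hpq hp2 hγ hL habar hmin
  have hD := (dualObj_ne_top_iff hγ).mp habar
  have hDa := (dualObj_ne_top_iff hγ).mp ha
  rw [dualObj_eq_coe hD, dualObj_eq_coe hDa, EReal.toReal_coe, EReal.toReal_coe]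
  set ubar := featureAdj Φ x abar with hubar
  set wbar := dualityMap hpq ubar with hwbar
  have h2 := Finset.sum_le_sum fun i (_ : i ∈ Finset.univ) =>
    le_conjugate_toReal (hDa i) (pairing (Φ (x i)) wbar)
  rw [Finset.sum_sub_distrib] at h1 h2
  have h4 : ∀ b : E n, γ * ∑ i, -(b i) / γ * pairing (Φ (x i)) wbar =
      - pairing (featureAdj Φ x b) wbar := by
    intro b
    rw [pairing_featureAdj hpq, Finset.mul_sum, ← Finset.sum_neg_distrib]
    refine Finset.sum_congr rfl fun i _ => ?_
    field_simp
  have h5 := mul_le_mul_of_nonneg_left h1 hγ.le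
  have h6 := mul_le_mul_of_nonneg_left h2 hγ.le
  rw [mul_sub, h4] at h5 h6
  have h7 := youngGap_dualityMap hpq ubar
  simp only [youngGap] at *
  linarith

theorem isMinOn_primalObj_iff (hpq : p.HolderConjugate q) (hp2 : p ≤ 2) (hγ : 0 < γ)
    (hL : ∀ b, ConvexOn ℝ Set.univ (L b)) {abar : E n} (habar : dualObj γ Φ L x y abar ≠ ⊤)
    (hmin : IsMinOn (dualObj γ Φ L x y) Set.univ abar) (w : Ell p K) :
    IsMinOn (primalObj γ Φ L x y : Ell p K → ℝ) Set.univ w ↔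
      w = dualityMap hpq (featureAdj Φ x abar) := by
  have := fact_one_le_ofReal hpq.lt.le
  have hgap := youngGap_le_primalObj_sub hpq hp2 hγ hL habar hmin
  set ubar := featureAdj Φ x abar
  constructor
  · intro h
    have h1 : primalObj γ Φ L x y w ≤ primalObj γ Φ L x y (dualityMap hpq ubar) :=
      h (Set.mem_univ _)
    obtain ⟨C, hC, hC'⟩ := exists_sq_norm_sub_dualityMap_le (K := K) hpq hp2 (max ‖ubar‖ ‖w‖)
    have h2 := hC' ubar w (le_max_left _ _) (le_max_right _ _)
    have h3 : youngGap ubar w ≤ 0 := by linarith [hgap w]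
    have h4 : ‖w - dualityMap hpq ubar‖ ^ 2 ≤ 0 :=
      h2.trans (mul_nonpos_of_nonneg_of_nonpos hC.le h3)
    have h5 : ‖w - dualityMap hpq ubar‖ = 0 :=
      pow_eq_zero_iff two_ne_zero |>.mp (le_antisymm h4 (sq_nonneg _))
    exact sub_eq_zero.mp (norm_eq_zero.mp h5)
  · rintro rfl z -
    have h1 := hgap z
    have h2 := youngGap_nonneg hpq hp2 ubar z
    show primalObj γ Φ L x y _ ≤ primalObj γ Φ L x y z
    linarith

end Duality

/-- Quadratic growth of a strongly convex function at a minimizer. -/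
theorem EStronglyConvexWith.sq_norm_sub_le {V : Type*} [NormedAddCommGroup V] [NormedSpace ℝ V]
    {f : V → EReal} {μ : ℝ} (hf : EStronglyConvexWith μ f) (hbot : ∀ v, f v ≠ ⊥) {u v : V}
    (hu : IsMinOn f Set.univ u) (hut : f u ≠ ⊤) (hv : f v ≠ ⊤) :
    μ / 4 * ‖u - v‖ ^ 2 ≤ (f v).toReal - (f u).toReal := by
  -- The midpoint gives half the excess at least `μ/8 ‖u - v‖²`, hence the constant `μ/4`.
  have h1 := hf u v (1 / 2) (by norm_num) (by norm_num)
  have h2 : f u ≤ f ((1 / 2 : ℝ) • u + (1 - 1 / 2 : ℝ) • v) := hu (Set.mem_univ _)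
  have h3 := (add_le_add_left h2 _).trans h1
  rw [← EReal.coe_toReal hut (hbot u), ← EReal.coe_toReal hv (hbot v), ← EReal.coe_mul,
    ← EReal.coe_mul, ← EReal.coe_add, ← EReal.coe_add, EReal.coe_le_coe_iff] at h3
  linarith

end

end DualLp

/-! ### The main theorem. -/

open DualLp
theorem theorem3 {X Y K : Type*} [Countable K] (p q : ℝ) (hp2 : p ≤ 2)
    (hpq : p.HolderConjugate q) (γ : ℝ) (hγ : 0 < γ) (n : ℕ) (Φ : X → Ell q K) (x : Fin n → X) :
    (∀ (L : Y → ℝ → ℝ) (_ : ∀ b, ConvexOn ℝ Set.univ (L b)) (y : Fin n → Y)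
        (φ₁ : E n → ℝ) (_ : ConvexOn ℝ Set.univ φ₁) (_ : Differentiable ℝ φ₁)
        (_ : LocallyLipschitz (gradient φ₁))
        (φ₂ : E n → EReal) (_ : EProper φ₂) (_ : LowerSemicontinuous φ₂) (_ : EConvex φ₂)
        (_ : ∀ a, dualObj γ Φ L x y a = (φ₁ a : EReal) + φ₂ a)
        (δ θ lamBar : ℝ) (_ : 0 < δ) (_ : δ < 1) (_ : 0 < θ) (_ : θ < 1) (_ : 0 < lamBar),
      -- the primal problem has a unique solution `wbar`
      ∃ wbar : Ell p K,
        (∀ w : Ell p K, IsMinOn (primalObj γ Φ L x y : Ell p K → ℝ) Set.univ w ↔ w = wbar) ∧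
        -- the algorithm is well defined from every starting point
        (∀ α₀ : E n, ∃ (α : ℕ → E n) (lam : ℕ → ℝ),
          α 0 = α₀ ∧ IsProxGradRun φ₁ φ₂ δ θ lamBar α lam) ∧
        -- convergence
        ∀ (α : ℕ → E n) (lam : ℕ → ℝ), IsProxGradRun φ₁ φ₂ δ θ lamBar α lam →
          0 < ⨅ m, lam m ∧
          ((fun m : ℕ => ‖dualityMap hpq (featureAdj Φ x (α m)) - wbar‖)
            =o[atTop] fun m : ℕ => 1 / √(m : ℝ)) ∧
          (EStronglyConvex (dualObj γ Φ L x y) →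
            ∃ C ρ : ℝ, 0 < ρ ∧ ρ < 1 ∧
              ∀ m : ℕ, ‖dualityMap hpq (featureAdj Φ x (α m)) - wbar‖ ≤ C * ρ ^ m)) ∧
    (∀ y : Fin n → ℝ, EStronglyConvex (dualObj γ Φ leastSquaresLoss x y)) ∧
    (∀ y : Fin n → ({-1, 1} : Set ℝ), EStronglyConvex (dualObj γ Φ logisticLoss x y)) := by
  have := fact_one_le_ofReal hpq.lt.le
  refine ⟨?_, fun y => dualObj_eStronglyConvex hγ hpq.symm.lt convexOn_sq_sub_leastSquaresLoss,
    fun y => dualObj_eStronglyConvex hγ hpq.symm.lt convexOn_sq_sub_logisticLoss⟩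
  intro L hL y φ₁ h1c h1d h1L φ₂ h2 h2l h2c hΛ δ θ lamBar hδ hδ1 hθ hθ1 hlam
  have htop : ∀ a, dualObj γ Φ L x y a ≠ ⊤ ↔ φ₂ a ≠ ⊤ := fun a => by
    rw [hΛ]
    refine ⟨fun h h' => h (by rw [h', EReal.coe_add_top]),
      fun h => EReal.add_ne_top (EReal.coe_ne_top _) h⟩
  have hreal : ∀ a, φ₂ a ≠ ⊤ → (dualObj γ Φ L x y a).toReal = φ₁ a + (φ₂ a).toReal := fun a ha => by
    rw [hΛ, EReal.toReal_add (EReal.coe_ne_top _) (EReal.coe_ne_bot _) ha (h2.1 a),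
      EReal.toReal_coe]
  have hlsc : LowerSemicontinuous (dualObj γ Φ L x y) := by
    have h : dualObj γ Φ L x y = fun a => φ₂ a + (φ₁ a : EReal) :=
      funext fun a => by rw [hΛ, add_comm]
    rw [h]
    exact lowerSemicontinuous_add_coe h2l h1d.continuous
  have hbot : ∀ a, dualObj γ Φ L x y a ≠ ⊥ := dualObj_ne_bot hγ hpq.symm.pos
  obtain ⟨v₀, hv₀⟩ := h2.2
  obtain ⟨abar, hmin⟩ := LowerSemicontinuous.exists_isMinOn_of_coercive hlsc ((htop v₀).mpr hv₀)
    (norm_sub_le_dualObj hγ hpq.symm.pos)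
  have hbar : dualObj γ Φ L x y abar ≠ ⊤ :=
    ne_top_of_le_ne_top ((htop v₀).mpr hv₀) (hmin (Set.mem_univ v₀))
  have hbar2 := (htop abar).mp hbar
  have hmin2 : ∀ v, φ₂ v ≠ ⊤ → φ₁ abar + (φ₂ abar).toReal ≤ φ₁ v + (φ₂ v).toReal := fun v hv => by
    rw [← hreal abar hbar2, ← hreal v hv]
    exact EReal.toReal_le_toReal (hmin (Set.mem_univ v)) (hbot _) ((htop v).mpr hv)
  refine ⟨dualityMap hpq (featureAdj Φ x abar), isMinOn_primalObj_iff hpq hp2 hγ hL hbar hmin,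
    exists_isProxGradRun h1c h1d h1L h2 h2l h2c hbar2 hmin2 hδ hθ hθ1 hlam,
    fun α lam hrun => ?_⟩
  obtain ⟨he0, hanti, ⟨R, hR⟩, b, κ, hb, hκ, hblam, hV⟩ := hrun.exists_lyapunov h1c h1d h1L h2 h2l
    h2c hbar2 hmin2 hδ hδ1 hθ hθ1 hlam fun m => rfl
  set wbar := dualityMap hpq (featureAdj Φ x abar) with hwbar
  set e : ℕ → ℝ := fun m => (φ₁ (α (m + 1)) + (φ₂ (α (m + 1))).toReal) -
      (φ₁ abar + (φ₂ abar).toReal) with he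
  set V : ℕ → ℝ := fun m => ‖abar - α (m + 1)‖ ^ 2 + κ * e m with hVdef
  have hV0 : ∀ m, 0 ≤ V m := fun m => add_nonneg (sq_nonneg _) (mul_nonneg hκ (he0 m))
  -- The radius covers `wbar` and all `Φₙ* α_m`, since `‖α_m‖ ≤ R + ‖abar‖`; one constant serves
  -- every iterate.
  obtain ⟨C, hC, hgap⟩ := exists_sq_norm_sub_dualityMap_le (K := K) hpq hp2
    (max (∑ i, (R + ‖abar‖) * ‖Φ (x i)‖) ‖wbar‖)
  have hde : ∀ m, ‖dualityMap hpq (featureAdj Φ x (α (m + 1))) - wbar‖ ^ 2 ≤ C * e m := fun m => by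
    have hα : ‖α (m + 1)‖ ≤ R + ‖abar‖ := by
      have := norm_add_le (α (m + 1) - abar) abar
      rw [sub_add_cancel] at this
      linarith [hR (m + 1)]
    have hm2 := hrun.ne_top h2 m
    have h1 := hgap (featureAdj Φ x (α (m + 1))) wbar
      ((norm_featureAdj_le hpq.symm.lt.le Φ x hα).trans (le_max_left _ _)) (le_max_right _ _)
    have h2 := youngGap_le_dualObj_sub hpq hp2 hγ hL hbar hmin ((htop _).mpr hm2)
    rw [hreal _ hm2, hreal _ hbar2] at h2
    rw [norm_sub_rev]
    exact h1.trans (mul_le_mul_of_nonneg_left h2 hC.le)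
  refine ⟨lt_of_lt_of_le hb (le_ciInf hblam), isLittleO_one_div_sqrt (fun m => norm_nonneg _)
    hanti he0 (summable_of_lyapunov hb he0 hV0 hV) hde, ?_⟩
  rintro ⟨μ, hμ, hsc⟩
  -- Quadratic growth bounds the squared distance in `V` by `(4/μ) e`; the remaining part of `V` is
  -- `κ e`.
  refine exists_linear_rate (c := 4 / μ + κ) (fun m => norm_nonneg _) hde hC.le hb (by positivity)
    hV (fun m => ?_) hV0
  have hm2 := hrun.ne_top h2 m
  have h3 := hsc.sq_norm_sub_le hbot hmin hbar ((htop _).mpr hm2)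
  rw [hreal _ hm2, hreal _ hbar2] at h3
  have h4 : ‖abar - α (m + 1)‖ ^ 2 ≤ 4 / μ * e m := by
    rw [div_mul_eq_mul_div, le_div_iff₀ hμ]
    simp only [he]
    linarith
  simp only [hVdef]
  linarith
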